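/- **Elliptic regularity.** For $0\le r\le d$ let $\Lambda^r(\mathbb{R}^d)$ be the space of alternating $r$-forms on $\mathbb{R}^d$ with orthonormal basis $(\mathrm{d}x_I)_{|I|=r}$, and write $u=\sum_{|I|=r}u_I\,\mathrm{d}x_I$, $\|u\|_{L^p\Lambda^r(V)}=\sum_{|I|=r}\|u_I\|_{L^p(V)}$. Let $d\ge 1$, $k\in\mathbb{N}=\{0,1,2,\dots\}$ and $\lambda\in(0,1]$. There exists a constant $C=C(d,k,\lambda)<\infty$ such that the following holds for every $1\le r\le d$, every linear map $\bar{\mathbf a}:\Lambda^r(\mathbb{R}^d)\to\Lambda^{d-r}(\mathbb{R}^d)$ satisfying $$p\wedge\bar{\mathbf a}q=q\wedge\bar{\mathbf a}p,\qquad \lambda|p|^2\le\star(p\wedge\bar{\mathbf a}p)\le\tfrac1\lambda|p|^2\qquad\text{for all }p,q\in\Lambda^r(\mathbb{R}^d),$$ every bounded open set $U\subseteq\mathbb{R}^d$ and every $R>0$. Let $u\in L^2\Lambda^{r-1}(U)$ have weak exterior derivative $\mathrm{d}u\in L^2\Lambda^r(U)$, that is, $\int_U\left(u\wedge\mathrm{d}v+(-1)^{r-1}\mathrm{d}u\wedge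 v\right)=0$ for every smooth compactly supported $(d-r)$-form $v$ on $U$, and let $u$ be a weak solution of $$\mathrm{d}(\bar{\mathbf a}\,\mathrm{d}u)=0\quad\text{in }U,$$ that is, $\int_U\mathrm{d}u\wedge\bar{\mathbf a}\,\mathrm{d}v=0$ for every smooth compactly supported $(r-1)$-form $v$ on $U$. Put $U_R:=\{x\in U:\operatorname{dist}(x,\partial U)>R\}$. Then the iterated distributional gradient $\nabla^k\mathrm{d}u=(\partial_{i_1}\cdots\partial_{i_k}\mathrm{d}u)_{1\le i_1,\dots,i_k\le d}$ (taken coefficient by coefficient) belongs to $L^\infty$ on $U_R$, and $$\|\nabla^k\mathrm{d}u\|_{L^\infty\Lambda^r(U_R)}:=\sum_{i_1,\dots,i_k=1}^d\|\partial_{i_1}\cdots\partial_{i_k}\mathrm{d}u\|_{L^\infty\Lambda^r(U_R)}\le\frac{C}{R^{k+d/2}}\,\|\mathrm{d}u\|_{L^2\Lambda^r(U)}.$$ -/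

import Mathlib

open MeasureTheory
open scoped ENNReal ContDiff

noncomputable section

namespace FormRegularity

/-- The Euclidean space `ℝ^d`. -/
abbrev Space (d : ℕ) : Type := EuclideanSpace ℝ (Fin d)

/-- The space `Λ^r(ℝ^d)` of alternating `r`-linear forms on `ℝ^d`. -/
abbrev Form (d r : ℕ) : Type := Space d [⋀^Fin r]→L[ℝ] ℝ

/-- The canonical basis vector `e_i` of `ℝ^d`. -/
def basisVec (d : ℕ) (i : Fin d) : Space d := EuclideanSpace.single i 1

/-- The coefficient `p_I` of `dx_I` in `p = ∑_I p_I dx_I`. The index set `I = {i_1 < ⋯ < i_r}` is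
encoded by its increasing enumeration. -/
def coeff {d r : ℕ} (p : Form d r) (I : Fin r ↪o Fin d) : ℝ :=
  p (fun j => basisVec d (I j))

/-- `|p|² = ∑_I p_I²`, the squared norm for which the `dx_I` are orthonormal. -/
def normSq {d r : ℕ} (p : Form d r) : ℝ := ∑ I : Fin r ↪o Fin d, coeff p I ^ 2

/-- The exterior product of a `p`-form and a `q`-form (the signed sum over shuffles). -/
def wedge {d p q : ℕ} (α : Form d p) (β : Form d q) : Space d [⋀^Fin (p + q)]→ₗ[ℝ] ℝ :=
  ((LinearMap.mul' ℝ ℝ).compAlternatingMap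
    (α.toAlternatingMap.domCoprod β.toAlternatingMap)).domDomCongr finSumFinEquiv

/-- The coefficient of `dx_1 ∧ ⋯ ∧ dx_d` in the `d`-form `α ∧ β`, where `p + q = d`; this is also
`⋆(α ∧ β)`. The integral of a `d`-form is the Lebesgue integral of this coefficient. -/
def topWedge {d p q : ℕ} (h : p + q = d) (α : Form d p) (β : Form d q) : ℝ :=
  wedge α β (fun i => basisVec d (Fin.cast h i))

/-- Smooth compactly supported `r`-forms on the open set `U`, that is `C_c^∞ Λ^r(U)`. -/
structure IsTestForm {d r : ℕ} (U : Set (Space d)) (v : Space d → Form d r) : Prop where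
  smooth : ContDiff ℝ ∞ v
  compact : HasCompactSupport v
  support : tsupport v ⊆ U

/-- Membership in `L^p Λ^r(V)`: each coefficient belongs to `L^p(V)`. -/
def MemLpForm {d r : ℕ} (p : ℝ≥0∞) (V : Set (Space d)) (u : Space d → Form d r) : Prop :=
  ∀ I : Fin r ↪o Fin d, MemLp (fun x => coeff (u x) I) p (volume.restrict V)

/-- The norm `‖u‖_{L^p Λ^r(V)} = ∑_I ‖u_I‖_{L^p(V)}`. -/
def lpNormForm {d r : ℕ} (p : ℝ≥0∞) (V : Set (Space d)) (u : Space d → Form d r) : ℝ≥0∞ :=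
  ∑ I : Fin r ↪o Fin d, eLpNorm (fun x => coeff (u x) I) p (volume.restrict V)

/-- `f` is the weak exterior derivative `du` on `U` of the `s`-form `u`:
`∫_U (u ∧ dv + (-1)^s f ∧ v) = 0` for every test form `v` of degree `q = d - s - 1`. -/
def HasWeakExtDeriv {d s q : ℕ} (h : (s + 1) + q = d) (U : Set (Space d))
    (u : Space d → Form d s) (f : Space d → Form d (s + 1)) : Prop :=
  ∀ v : Space d → Form d q, IsTestForm U v →
    ∫ x in U, (topWedge ((show s + (q + 1) = s + 1 + q by omega).trans h) (u x) (extDeriv v x)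
      + (-1) ^ s * topWedge h (f x) (v x)) = 0

/-- The constant coefficient `a : Λ^r(ℝ^d) → Λ^{d-r}(ℝ^d)` is symmetric and elliptic with
constant `lam`. -/
structure IsEllipticCoeff {d r q : ℕ} (h : r + q = d) (lam : ℝ)
    (a : Form d r →ₗ[ℝ] Form d q) : Prop where
  symm : ∀ p p' : Form d r, topWedge h p (a p') = topWedge h p' (a p)
  lower : ∀ p : Form d r, lam * normSq p ≤ topWedge h p (a p)
  upper : ∀ p : Form d r, topWedge h p (a p) ≤ 1 / lam * normSq p

/-- `u ∈ H^1_d Λ^s(U)`, with weak exterior derivative `du`, is a weak solution of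
`d(a du) = 0` in `U`: `∫_U du ∧ a dv = 0` for every test form `v` of degree `s`. -/
structure IsSolution {d s q : ℕ} (h : (s + 1) + q = d) (a : Form d (s + 1) →ₗ[ℝ] Form d q)
    (U : Set (Space d)) (u : Space d → Form d s) (du : Space d → Form d (s + 1)) : Prop where
  memLp : MemLpForm 2 U u
  memLp_deriv : MemLpForm 2 U du
  hasDeriv : HasWeakExtDeriv h U u du
  weakEq : ∀ v : Space d → Form d s, IsTestForm U v →
    ∫ x in U, topWedge h (du x) (a (extDeriv v x)) = 0

/-- `g` is the distributional derivative `∂_{i_1} ⋯ ∂_{i_k} w` of the form `w` on the open set `V`,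
where `i = (i_1, …, i_k)` and derivatives of forms are taken coefficient by coefficient. -/
def HasWeakPartial {d r k : ℕ} (V : Set (Space d)) (i : Fin k → Fin d)
    (w g : Space d → Form d r) : Prop :=
  ∀ (I : Fin r ↪o Fin d) (φ : Space d → ℝ),
    ContDiff ℝ ∞ φ → HasCompactSupport φ → tsupport φ ⊆ V →
    ∫ x in V, coeff (w x) I * iteratedFDeriv ℝ k φ x (fun j => basisVec d (i j))
      = (-1) ^ k * ∫ x in V, coeff (g x) I * φ x

/-- `U_R = {x ∈ U : dist(x, ∂U) > R}`. -/
def innerSet {d : ℕ} (U : Set (Space d)) (R : ℝ) : Set (Space d) :=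
  {x | x ∈ U ∧ R < Metric.infDist x (frontier U)}

end FormRegularity

end

noncomputable section

namespace FormRegularity

open ContinuousAlternatingMap Topology

/-! ### Multilinear algebra: the top-degree wedge pairing and its nondegeneracy. -/

section

variable {d r q : ℕ}

/-! Put `f = du`. All that is used about `f` is the first-order system `df = 0`, `d(a f) = 0`. Its
coefficients are constant, so every directional derivative of a smooth solution is again a solution,
and so is every mollification of a weak solution, away from the boundary.

The energy estimate needs neither the potential `u` nor a gauge. For a constant vector `e` and a
cutoff `η`, the derivative `∂_e f` is tested against `v = η² ι_e f`. Cartan's formula and `df = 0`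
give `d(ι_e f) = ∂_e f`, hence `dv = η² ∂_e f + 2η dη ∧ ι_e f`. Ellipticity then bounds `η ∂_e f` in
`L²` by `|∇η| |f|` (`exists_caccioppoli`). Iterating controls all derivatives in `L²` on smaller
balls. The elementary Sobolev bound `|g(x)| ≤ ∫ |∂_1 ⋯ ∂_d g|` for compactly supported `g` makes
this a pointwise bound at the centre of the unit ball, and scaling yields the factor `R^{-(k+d/2)}`
(`exists_partials_bound`).

For a weak solution, `f` is extended by zero and mollified. Mollifications are classical solutions
on balls of radius `R/2` centred in `U_R` (`IsSolution.isSmoothSol_mollify`). The interior estimate,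
applied to differences of two of them, shows that their `k`-th derivatives are uniformly Cauchy on
`U_R`. The limit is the weak derivative and inherits the bound (`exists_weak_limit`,
`exists_weakPartial`).

On the algebraic side, the weak identity defining `du` only pairs with test forms.
`alternatize_eq_zero` uses the nondegeneracy of the wedge pairing to recover the pointwise equation
`df = 0`. -/

lemma basisFun_eq_basisVec (i : Fin d) :
    (EuclideanSpace.basisFun (Fin d) ℝ).toBasis i = basisVec d i := by
  simp [basisVec]

lemma basisVec_apply (i j : Fin d) : basisVec d i j = if j = i then 1 else 0 := by
  simp [basisVec]

lemma form_eq_zero_of_basis (p : Form d r)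
    (h : ∀ m : Fin r → Fin d, Function.Injective m → p (fun j => basisVec d (m j)) = 0) :
    p = 0 := by
  apply ContinuousAlternatingMap.toAlternatingMap_injective
  refine Module.Basis.ext_alternating (EuclideanSpace.basisFun (Fin d) ℝ).toBasis fun m hm => ?_
  simpa [basisFun_eq_basisVec] using h m hm

lemma map_comp_perm (p : Form d r) (v : Fin r → Space d) (σ : Equiv.Perm (Fin r)) :
    p (fun j => v (σ j)) = ((Equiv.Perm.sign σ : ℤ) : ℝ) * p v := by
  have := p.toAlternatingMap.map_perm v σ
  simpa [Function.comp_def, Units.smul_def] using this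

/-- Sorting an injective index tuple makes it increasing and changes the value of the form by a sign
only. -/
lemma form_eq_zero_of_coeff (p : Form d r) (h : ∀ I, coeff p I = 0) : p = 0 := by
  refine form_eq_zero_of_basis p fun m hm => ?_
  have hs : StrictMono (m ∘ Tuple.sort m) :=
    (Tuple.monotone_sort m).strictMono_of_injective (hm.comp (Tuple.sort m).injective)
  have h1 := h (OrderEmbedding.ofStrictMono _ hs)
  have h2 := map_comp_perm p (fun j => basisVec d (m j)) (Tuple.sort m)
  rw [show (p fun j => basisVec d (m (Tuple.sort m j))) = 0 from h1] at h2
  rcases mul_eq_zero.mp h2.symm with h3 | h3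
  · norm_cast at h3
    exact absurd h3 (Units.ne_zero _)
  · exact h3

/-- The splitting of the indices of a top-degree form into two blocks. -/
def splitIndex (h : r + q = d) : Fin r ⊕ Fin q ≃ Fin d := finSumFinEquiv.trans (finCongr h)

/-- Each shuffle class contains `r! q!` permutations with equal contributions. Sums over the full
symmetric group can be reindexed freely, which shuffle sums cannot. -/
lemma topWedge_eq_sum (h : r + q = d) (p : Form d r) (b : Form d q) :
    ((r.factorial * q.factorial : ℕ) : ℝ) * topWedge h p b =
      ∑ σ : Equiv.Perm (Fin d), ((Equiv.Perm.sign σ : ℤ) : ℝ) *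
        (p (fun j => basisVec d (σ (splitIndex h (.inl j)))) *
          b (fun j => basisVec d (σ (splitIndex h (.inr j))))) := by
  have key := congrArg (fun F => LinearMap.mul' ℝ ℝ (F fun i => basisVec d (splitIndex h i)))
    (MultilinearMap.domCoprod_alternization_eq p.toAlternatingMap b.toAlternatingMap)
  simp only [AlternatingMap.smul_apply, Fintype.card_fin, map_nsmul] at key
  rw [topWedge, wedge]
  have h1 : (((LinearMap.mul' ℝ ℝ).compAlternatingMap
      (p.toAlternatingMap.domCoprod b.toAlternatingMap)).domDomCongr finSumFinEquiv)
      (fun i => basisVec d (Fin.cast h i)) = LinearMap.mul' ℝ ℝ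
      ((p.toAlternatingMap.domCoprod b.toAlternatingMap) fun i => basisVec d (splitIndex h i)) := by
    rfl
  rw [h1, ← nsmul_eq_mul, ← key, MultilinearMap.alternatization_apply, _root_.map_sum]
  refine Fintype.sum_equiv ((splitIndex h).permCongr) _ _ fun σ => ?_
  rcases Int.units_eq_one_or (Equiv.Perm.sign σ) with hs | hs <;>
    simp [hs, Equiv.Perm.sign_permCongr]

lemma sum_perm_comp (F : Equiv.Perm (Fin d) → ℝ) (τ : Equiv.Perm (Fin d)) :
    ∑ σ : Equiv.Perm (Fin d), ((Equiv.Perm.sign σ : ℤ) : ℝ) * F (σ * τ) =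
      ((Equiv.Perm.sign τ : ℤ) : ℝ) *
        ∑ σ : Equiv.Perm (Fin d), ((Equiv.Perm.sign σ : ℤ) : ℝ) * F σ := by
  rw [Finset.mul_sum]
  conv_rhs => rw [← Equiv.sum_comp (Equiv.mulRight τ)]
  refine Finset.sum_congr rfl fun σ _ => ?_
  rcases Int.units_eq_one_or (Equiv.Perm.sign τ) with h | h <;>
    simp [Equiv.Perm.sign_mul, h]

/-- The exterior product `dx_i ∧ b`. -/
def dxWedge (i : Fin d) (b : Form d q) : Form d (q + 1) :=
  alternatizeUncurryFin (((EuclideanSpace.proj i : Space d →L[ℝ] ℝ)).smulRight b)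

lemma dxWedge_apply (i : Fin d) (b : Form d q) (v : Fin (q + 1) → Space d) :
    dxWedge i b v = ∑ j, ((-1) ^ j.val : ℝ) * (v j i * b (j.removeNth v)) := by
  simp [dxWedge, alternatizeUncurryFin_apply]

lemma sum_apply_basisVec (L : Space d →L[ℝ] Form d r) (m : Fin d) (w : Fin r → Space d) :
    ∑ i, L (basisVec d i) w * basisVec d m i = L (basisVec d m) w := by
  simp [basisVec_apply]

/-- Both `∑ L e_i ∧ (dx_i ∧ b)` and `± (∑ dx_i ∧ L e_i) ∧ b` are multiples of this sum. -/
def pairSum (h : r + (q + 1) = d) (L : Space d →L[ℝ] Form d r) (b : Form d q) : ℝ :=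
  ∑ σ : Equiv.Perm (Fin d), ((Equiv.Perm.sign σ : ℤ) : ℝ) *
    (L (basisVec d (σ (splitIndex h (.inr 0))))
        (fun j => basisVec d (σ (splitIndex h (.inl j)))) *
      b (fun j => basisVec d (σ (splitIndex h (.inr j.succ)))))

/-- Expanding `dx_i ∧ b` singles out one slot `j` of the second block, and the sum over `i` feeds
the vector in that slot to `L`. A cycle moving slot `0` to slot `j` has sign `(-1)^j`, so all `q +
1` terms agree with the one for `j = 0`. -/
lemma sum_topWedge_dxWedge (h : r + (q + 1) = d) (L : Space d →L[ℝ] Form d r) (b : Form d q) :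
    ((r.factorial * (q + 1).factorial : ℕ) : ℝ) *
      ∑ i, topWedge h (L (basisVec d i)) (dxWedge i b) = (q + 1 : ℕ) * pairSum h L b := by
  rw [Finset.mul_sum]
  simp only [topWedge_eq_sum, dxWedge_apply]
  rw [Finset.sum_comm]
  have h1 : ∀ σ : Equiv.Perm (Fin d),
      (∑ i, ((Equiv.Perm.sign σ : ℤ) : ℝ) *
        (L (basisVec d i) (fun j => basisVec d (σ (splitIndex h (.inl j)))) *
          ∑ j : Fin (q + 1), ((-1) ^ j.val : ℝ) * (basisVec d (σ (splitIndex h (.inr j))) i *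
            b (j.removeNth fun j => basisVec d (σ (splitIndex h (.inr j))))))) =
      ∑ j : Fin (q + 1), ((-1) ^ j.val : ℝ) * (((Equiv.Perm.sign σ : ℤ) : ℝ) *
        (L (basisVec d (σ (splitIndex h (.inr j))))
          (fun j => basisVec d (σ (splitIndex h (.inl j)))) *
        b (j.removeNth fun j => basisVec d (σ (splitIndex h (.inr j)))))) := by
    intro σ
    simp_rw [Finset.mul_sum]
    rw [Finset.sum_comm]
    refine Finset.sum_congr rfl fun j _ => ?_
    rw [← sum_apply_basisVec, Finset.sum_mul, Finset.mul_sum, Finset.mul_sum]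
    refine Finset.sum_congr rfl fun i _ => ?_
    ring
  rw [Finset.sum_congr rfl fun σ _ => h1 σ, Finset.sum_comm]
  have h2 : ∀ j : Fin (q + 1), (∑ σ : Equiv.Perm (Fin d), ((-1) ^ j.val : ℝ) *
      (((Equiv.Perm.sign σ : ℤ) : ℝ) *
        (L (basisVec d (σ (splitIndex h (.inr j))))
          (fun j => basisVec d (σ (splitIndex h (.inl j)))) *
        b (j.removeNth fun j => basisVec d (σ (splitIndex h (.inr j))))))) = pairSum h L b := by
    intro j
    set τ : Equiv.Perm (Fin d) := (splitIndex h).permCongr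
      (Equiv.sumCongr (Equiv.refl _) j.cycleRange.symm) with hτ
    have hs : ((Equiv.Perm.sign τ : ℤ) : ℝ) = (-1) ^ j.val := by
      rw [hτ, Equiv.Perm.sign_permCongr, Equiv.Perm.sign_sumCongr]
      simp [Equiv.Perm.sign_symm, Fin.sign_cycleRange]
    have h3 := sum_perm_comp (fun σ => L (basisVec d (σ (splitIndex h (.inr 0))))
        (fun j => basisVec d (σ (splitIndex h (.inl j)))) *
      b (fun j => basisVec d (σ (splitIndex h (.inr j.succ))))) τ
    rw [← Finset.mul_sum]
    have h4 : ∀ x y : ℝ, x = (-1) ^ j.val * y → (-1) ^ j.val * x = y := by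
      intro x y hxy
      rw [hxy, ← mul_assoc, ← mul_pow]; simp
    apply h4
    rw [pairSum, ← hs, ← h3]
    refine Finset.sum_congr rfl fun σ _ => ?_
    simp [hτ, Equiv.Perm.mul_apply, Equiv.permCongr_apply]
    exact Or.inl rfl
  rw [Finset.sum_congr rfl fun j _ => h2 j]
  simp

/-- The same cycle argument is applied to the first block. Only the vanishing of `pairSum` will be
transported, so the value of `ε` is immaterial. -/
lemma topWedge_alternatize (h : r + (q + 1) = d) (h' : r + 1 + q = d)
    (L : Space d →L[ℝ] Form d r) (b : Form d q) :
    ∃ ε : ℝ, (((r + 1).factorial * q.factorial : ℕ) : ℝ) *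
      topWedge h' (alternatizeUncurryFin L) b = ε * pairSum h L b := by
  -- `ρ` moves the first slot of the second block to the very front and shifts the first block by
  -- one. It compares the splittings `r + (q + 1)` and `(r + 1) + q`.
  set ρ : Equiv.Perm (Fin d) := (splitIndex h).symm.trans
    (((Equiv.sumCongr (Equiv.refl (Fin r)) (finSumFinEquiv (m := 1) (n := q)|>.trans
      (finCongr (Nat.add_comm 1 q))).symm).trans ((Equiv.sumAssoc _ _ _).symm.trans
        (Equiv.sumCongr ((Equiv.sumComm _ _).trans (finSumFinEquiv.trans
          (finCongr (Nat.add_comm 1 r)))) (Equiv.refl _)))).trans (splitIndex h')) with hρ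
  have hρl : ∀ j : Fin r, ρ (splitIndex h (.inl j)) = splitIndex h' (.inl j.succ) := by
    intro j
    simp only [hρ, Equiv.trans_apply, Equiv.symm_apply_apply]
    congr 1
    simp
  have es : ∀ j : Fin q, (finSumFinEquiv (m := 1) (n := q)|>.trans
      (finCongr (Nat.add_comm 1 q))).symm j.succ = .inr j := by
    intro j
    rw [Equiv.symm_apply_eq]; ext; simp
  have hρ0 : ρ (splitIndex h (.inr 0)) = splitIndex h' (.inl 0) := by
    simp only [hρ, Equiv.trans_apply, Equiv.symm_apply_apply, Equiv.sumCongr_apply, Sum.map_inr]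
    congr 1
  have hρr : ∀ j : Fin q, ρ (splitIndex h (.inr j.succ)) = splitIndex h' (.inr j) := by
    intro j
    simp only [hρ, Equiv.trans_apply, Equiv.symm_apply_apply, Equiv.sumCongr_apply, Sum.map_inr]
    congr 1
    have := es j
    simp only [Equiv.symm_trans_apply] at this ⊢
    rw [this]
    simp
  refine ⟨(r + 1 : ℕ) * ((Equiv.Perm.sign ρ : ℤ) : ℝ), ?_⟩
  rw [mul_assoc, pairSum]
  have h3 := sum_perm_comp (fun σ => L (basisVec d (σ (splitIndex h (.inr 0))))
        (fun j => basisVec d (σ (splitIndex h (.inl j)))) *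
      b (fun j => basisVec d (σ (splitIndex h (.inr j.succ))))) ρ
  rw [← h3, topWedge_eq_sum]
  simp only [Equiv.Perm.mul_apply, hρ0, hρl, hρr]
  have h5 : ∀ σ : Equiv.Perm (Fin d), ((Equiv.Perm.sign σ : ℤ) : ℝ) *
      (alternatizeUncurryFin L (fun j => basisVec d (σ (splitIndex h' (.inl j)))) *
        b (fun j => basisVec d (σ (splitIndex h' (.inr j))))) =
      ∑ j : Fin (r + 1), ((-1) ^ j.val : ℝ) * (((Equiv.Perm.sign σ : ℤ) : ℝ) *
        (L (basisVec d (σ (splitIndex h' (.inl j))))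
          (j.removeNth fun j => basisVec d (σ (splitIndex h' (.inl j)))) *
        b (fun j => basisVec d (σ (splitIndex h' (.inr j)))))) := by
    intro σ
    rw [alternatizeUncurryFin_apply, Finset.sum_mul, Finset.mul_sum]
    refine Finset.sum_congr rfl fun i _ => ?_
    simp only [zsmul_eq_mul, Int.cast_pow, Int.cast_neg, Int.cast_one]
    ring
  rw [Finset.sum_congr rfl fun σ _ => h5 σ, Finset.sum_comm]
  have h2 : ∀ j : Fin (r + 1), (∑ σ : Equiv.Perm (Fin d), ((-1) ^ j.val : ℝ) *
      (((Equiv.Perm.sign σ : ℤ) : ℝ) *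
        (L (basisVec d (σ (splitIndex h' (.inl j))))
          (j.removeNth fun j => basisVec d (σ (splitIndex h' (.inl j)))) *
        b (fun j => basisVec d (σ (splitIndex h' (.inr j))))))) =
      ∑ σ : Equiv.Perm (Fin d), ((Equiv.Perm.sign σ : ℤ) : ℝ) *
        (L (basisVec d (σ (splitIndex h' (.inl 0))))
          (fun j => basisVec d (σ (splitIndex h' (.inl j.succ)))) *
        b (fun j => basisVec d (σ (splitIndex h' (.inr j))))) := by
    intro j
    set τ : Equiv.Perm (Fin d) := (splitIndex h').permCongr
      (Equiv.sumCongr j.cycleRange.symm (Equiv.refl _)) with hτ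
    have hs : ((Equiv.Perm.sign τ : ℤ) : ℝ) = (-1) ^ j.val := by
      rw [hτ, Equiv.Perm.sign_permCongr, Equiv.Perm.sign_sumCongr]
      simp [Equiv.Perm.sign_symm, Fin.sign_cycleRange]
    have h3 := sum_perm_comp (fun σ => L (basisVec d (σ (splitIndex h' (.inl 0))))
        (fun j => basisVec d (σ (splitIndex h' (.inl j.succ)))) *
      b (fun j => basisVec d (σ (splitIndex h' (.inr j))))) τ
    rw [← Finset.mul_sum]
    have h4 : ∀ x y : ℝ, x = (-1) ^ j.val * y → (-1) ^ j.val * x = y := by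
      intro x y hxy
      rw [hxy, ← mul_assoc, ← mul_pow]; simp
    apply h4
    rw [← hs, ← h3]
    refine Finset.sum_congr rfl fun σ _ => ?_
    simp [hτ, Equiv.Perm.mul_apply, Equiv.permCongr_apply]
    exact Or.inl rfl
  rw [Finset.sum_congr rfl fun j _ => h2 j]
  simp

/-- The minor of the coordinates with indices `m`, as a form of degree `q`. -/
def minorForm (m : Fin q → Fin d) : Form d q :=
  { (Matrix.detRowAlternating (n := Fin q) (R := ℝ)).compLinearMap
      (LinearMap.pi fun k =>
        ((EuclideanSpace.proj (m k) : Space d →L[ℝ] ℝ) : Space d →ₗ[ℝ] ℝ)) with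
    cont := by
      change Continuous fun v : Fin q → Space d => Matrix.det (fun j k => v j (m k))
      refine Continuous.matrix_det ?_
      fun_prop }

lemma minorForm_apply (m : Fin q → Fin d) (v : Fin q → Space d) :
    minorForm m v = Matrix.det (Matrix.of fun j k => v j (m k)) := rfl

/-- Pairing `p` with the minor of the coordinates complementary to `m` isolates the value of `p` on
the basis vectors indexed by `m`: every other shuffle contributes zero. -/
lemma eq_zero_of_topWedge_eq_zero (h : r + q = d) (p : Form d r)
    (hp : ∀ b : Form d q, topWedge h p b = 0) : p = 0 := by
  refine form_eq_zero_of_basis p fun m hm => ?_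
  obtain ⟨τ, hτ⟩ : ∃ τ : Fin r ⊕ Fin q ≃ Fin d, ∀ j, τ (.inl j) = m j := by
    obtain ⟨σ, hσ⟩ := Equiv.Perm.exists_extending_pair
      (fun j : Fin r => splitIndex h (.inl j)) m
      ((splitIndex h).injective.comp Sum.inl_injective) hm
    exact ⟨(splitIndex h).trans σ, fun j => hσ j⟩
  set b : Form d q := minorForm fun k => τ (.inr k) with hb
  have h0 : LinearMap.mul' ℝ ℝ ((p.toAlternatingMap.domCoprod b.toAlternatingMap)
      fun i => basisVec d (τ i)) = 0 := by
    have h1 := (((LinearMap.mul' ℝ ℝ).compAlternatingMap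
      (p.toAlternatingMap.domCoprod b.toAlternatingMap))).map_perm
        (fun i => basisVec d (splitIndex h i)) (τ.trans (splitIndex h).symm)
    have h2 : ((LinearMap.mul' ℝ ℝ).compAlternatingMap
      (p.toAlternatingMap.domCoprod b.toAlternatingMap))
        (fun i => basisVec d (splitIndex h i)) = 0 := hp b
    rw [h2, smul_zero] at h1
    simpa [Function.comp_def] using h1
  rw [← AlternatingMap.coe_multilinearMap, AlternatingMap.domCoprod_coe,
    _root_.sum_apply, _root_.map_sum] at h0
  have hvan : ∀ σ : Equiv.Perm.ModSumCongr (Fin r) (Fin q), σ ≠ Quotient.mk'' 1 →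
      AlternatingMap.domCoprod.summand p.toAlternatingMap b.toAlternatingMap σ
        (fun i => basisVec d (τ i)) = 0 := by
    intro σ hσ
    induction σ using Quotient.inductionOn' with
    | h σ =>
    rw [AlternatingMap.domCoprod.summand_mk'']
    suffices hbz : b (fun j => basisVec d (τ (σ (.inr j)))) = 0 by
      simp [hbz]
    by_contra hne
    apply hσ
    rw [Quotient.eq'', QuotientGroup.leftRel_apply]
    -- If `σ` sends a slot of the second block outside that block, the minor has a zero row.
    -- Otherwise `σ` preserves both blocks and lies in the trivial class.
    have hmaps : Set.MapsTo σ (Set.range Sum.inr) (Set.range Sum.inr) := by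
      rintro _ ⟨j, rfl⟩
      by_contra hj
      apply hne
      rw [hb, minorForm_apply]
      refine Matrix.det_eq_zero_of_row_eq_zero j fun k => ?_
      simp only [Matrix.of_apply, basisVec_apply, ite_eq_right_iff, one_ne_zero, imp_false]
      intro hk
      exact hj ⟨k, τ.injective hk⟩
    have hinl := (Equiv.Perm.perm_mapsTo_inl_iff_mapsTo_inr σ).mpr hmaps
    simpa using Equiv.Perm.mem_sumCongrHom_range_of_perm_mapsTo_inl hinl
  have h3 : LinearMap.mul' ℝ ℝ (AlternatingMap.domCoprod.summand p.toAlternatingMap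
      b.toAlternatingMap (Quotient.mk'' 1) fun i => basisVec d (τ i)) = 0 := by
    refine Eq.trans (Eq.symm ?_) h0
    apply Finset.sum_eq_single
    · exact fun σ _ hσ => by
        rw [hvan σ hσ, _root_.map_zero]
    · simp
  have hdet : b (fun j => basisVec d (τ (.inr j))) = 1 := by
    rw [hb, minorForm_apply, ← Matrix.det_one (n := Fin q)]
    congr 1
    ext j k
    simp [basisVec_apply, Matrix.one_apply, eq_comm]
  rw [AlternatingMap.domCoprod.summand_mk''] at h3
  simpa [hdet, hτ] using h3

/-- With `L = ∇f`, this passes from "`f` paired with the divergence structure vanishes" to `df = 0`.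
Up to constants, both expressions are the same permutation sum. -/
lemma alternatize_eq_zero (h : r + (q + 1) = d) (h' : r + 1 + q = d)
    (L : Space d →L[ℝ] Form d r)
    (hL : ∀ b : Form d q, ∑ i, topWedge h (L (basisVec d i)) (dxWedge i b) = 0) :
    alternatizeUncurryFin L = 0 := by
  refine eq_zero_of_topWedge_eq_zero h' _ fun b => ?_
  have h1 := sum_topWedge_dxWedge h L b
  rw [hL b, mul_zero, eq_comm, mul_eq_zero, or_iff_right (by positivity)] at h1
  obtain ⟨ε, h2⟩ := topWedge_alternatize h h' L b
  rw [h1, mul_zero, mul_eq_zero, or_iff_right (by positivity)] at h2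
  exact h2

end

/-! ### Norms on forms, the energy bilinear form and interior multiplication. -/

section

variable {d r q s : ℕ}

/-- The coefficient of `dx_I`, as a continuous linear functional. -/
def coeffL (I : Fin r ↪o Fin d) : Form d r →L[ℝ] ℝ :=
  ContinuousAlternatingMap.apply ℝ (Space d) ℝ fun j => basisVec d (I j)

lemma norm_basisVec (i : Fin d) : ‖basisVec d i‖ = 1 := by simp [basisVec]

lemma abs_coeff_le (p : Form d r) (I : Fin r ↪o Fin d) : |coeff p I| ≤ ‖p‖ := by
  have := p.le_opNorm fun j => basisVec d (I j)
  simpa [norm_basisVec, coeff] using this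

/-- The tuple of all coefficients. -/
def coeffs (d r : ℕ) : Form d r →ₗ[ℝ] ((Fin r ↪o Fin d) → ℝ) :=
  LinearMap.pi fun I => (coeffL I : Form d r →ₗ[ℝ] ℝ)

lemma ker_coeffs : LinearMap.ker (coeffs d r) = ⊥ := by
  rw [LinearMap.ker_eq_bot']
  exact fun p hp => form_eq_zero_of_coeff p fun I => congrFun hp I

instance : FiniteDimensional ℝ (Form d r) :=
  FiniteDimensional.of_injective (coeffs d r) (LinearMap.ker_eq_bot.mp ker_coeffs)

lemma norm_le_coeff (d r : ℕ) : ∃ K : ℝ, 0 < K ∧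
    ∀ p : Form d r, (‖p‖ ≤ K * ∑ I : Fin r ↪o Fin d, |coeff p I|) ∧ ‖p‖ ^ 2 ≤ K * normSq p ∧
      normSq p ≤ K * ‖p‖ ^ 2 := by
  obtain ⟨K, hK, hA⟩ := (coeffs d r).exists_antilipschitzWith ker_coeffs
  have hK' : (0 : ℝ) < K := hK
  set N : ℝ := (Fintype.card (Fin r ↪o Fin d) : ℝ)
  have hN : 0 ≤ N := Nat.cast_nonneg _
  -- The three inequalities need `K`, `K²` and `N` respectively, and the sum serves for all.
  refine ⟨K + K ^ 2 + N, by positivity, fun p => ?_⟩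
  have h1 : ‖p‖ ≤ K * ‖coeffs d r p‖ := by simpa using hA.le_mul_norm_sub p 0
  have hs0 : 0 ≤ ∑ I : Fin r ↪o Fin d, |coeff p I| := Finset.sum_nonneg fun _ _ => abs_nonneg _
  have hn0 : 0 ≤ normSq p := Finset.sum_nonneg fun _ _ => sq_nonneg _
  have h2 : ‖coeffs d r p‖ ≤ ∑ I : Fin r ↪o Fin d, |coeff p I| := by
    refine (pi_norm_le_iff_of_nonneg hs0).mpr fun I => ?_
    exact Finset.single_le_sum (f := fun I => |coeff p I|) (fun _ _ => abs_nonneg _)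
      (Finset.mem_univ I)
  have h3 : ‖coeffs d r p‖ ^ 2 ≤ normSq p := by
    have : ‖coeffs d r p‖ ≤ √(normSq p) := by
      refine (pi_norm_le_iff_of_nonneg (Real.sqrt_nonneg _)).mpr fun I => ?_
      refine Real.abs_le_sqrt ?_
      exact Finset.single_le_sum (f := fun I => coeff p I ^ 2) (fun _ _ => sq_nonneg _)
        (Finset.mem_univ I)
    calc _ ≤ √(normSq p) ^ 2 := by gcongr
      _ = _ := Real.sq_sqrt hn0
  have h4 : normSq p ≤ N * ‖p‖ ^ 2 := by
    rw [normSq]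
    calc _ ≤ ∑ _I : Fin r ↪o Fin d, ‖p‖ ^ 2 := Finset.sum_le_sum fun I _ => by
          rw [← sq_abs]; gcongr; exact abs_coeff_le p I
      _ = _ := by simp [N]
  refine ⟨?_, ?_, ?_⟩
  · calc ‖p‖ ≤ K * ∑ I : Fin r ↪o Fin d, |coeff p I| := h1.trans (by gcongr)
      _ ≤ _ := by gcongr; nlinarith [sq_nonneg (K : ℝ)]
  · calc ‖p‖ ^ 2 ≤ (K * ‖coeffs d r p‖) ^ 2 := by gcongr
      _ = K ^ 2 * ‖coeffs d r p‖ ^ 2 := by ring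
      _ ≤ K ^ 2 * normSq p := by gcongr
      _ ≤ _ := by gcongr; linarith
  · exact h4.trans (by gcongr; nlinarith [sq_nonneg (K : ℝ)])

lemma topWedge_eq (h : r + q = d) (p : Form d r) (b : Form d q) :
    topWedge h p b = ((r.factorial * q.factorial : ℕ) : ℝ)⁻¹ *
      ∑ σ : Equiv.Perm (Fin d), ((Equiv.Perm.sign σ : ℤ) : ℝ) *
        (p (fun j => basisVec d (σ (splitIndex h (.inl j)))) *
          b (fun j => basisVec d (σ (splitIndex h (.inr j))))) := by
  rw [← topWedge_eq_sum, inv_mul_cancel_left₀ (by positivity)]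

/-- The pairing `(p, b) ↦ ⋆(p ∧ b)` as a continuous bilinear map. -/
def topWedgeL (h : r + q = d) : Form d r →L[ℝ] Form d q →L[ℝ] ℝ :=
  LinearMap.toContinuousBilinearMap <| LinearMap.mk₂ ℝ (topWedge h)
    (fun p p' b => by
      simp only [topWedge_eq, ContinuousAlternatingMap.add_apply, add_mul, mul_add, Finset.sum_add_distrib])
    (fun c p b => by
      simp only [topWedge_eq, ContinuousAlternatingMap.smul_apply, smul_eq_mul, Finset.mul_sum]
      exact Finset.sum_congr rfl fun _ _ => by ring)
    (fun p b b' => by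
      simp only [topWedge_eq, ContinuousAlternatingMap.add_apply, mul_add, Finset.sum_add_distrib])
    (fun c p b => by
      simp only [topWedge_eq, ContinuousAlternatingMap.smul_apply, smul_eq_mul, Finset.mul_sum]
      exact Finset.sum_congr rfl fun _ _ => by ring)

/-- A symmetric elliptic bilinear form on `Λ^r(ℝ^d)`. -/
structure IsEllipticForm (lam : ℝ) (A : Form d r →L[ℝ] Form d r →L[ℝ] ℝ) : Prop where
  symm : ∀ p p', A p p' = A p' p
  lower : ∀ p, lam * normSq p ≤ A p p
  upper : ∀ p, A p p ≤ 1 / lam * normSq p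

/-- The bilinear form `(p, w) ↦ ⋆(p ∧ a w)`. -/
def energyForm (h : r + q = d) (a : Form d r →ₗ[ℝ] Form d q) :
    Form d r →L[ℝ] Form d r →L[ℝ] ℝ :=
  (topWedgeL h).bilinearComp (ContinuousLinearMap.id ℝ _) (LinearMap.toContinuousLinearMap a)

lemma IsEllipticCoeff.energyForm {h : r + q = d} {lam : ℝ} {a : Form d r →ₗ[ℝ] Form d q}
    (ha : IsEllipticCoeff h lam a) : IsEllipticForm lam (energyForm h a) :=
  ⟨ha.symm, ha.lower, ha.upper⟩

lemma alternatize_eq_sum (L : Space d →L[ℝ] Form d s) :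
    alternatizeUncurryFin L = ∑ i, dxWedge i (L (basisVec d i)) := by
  have hL : L = ∑ i, (EuclideanSpace.proj i : Space d →L[ℝ] ℝ).smulRight (L (basisVec d i)) := by
    ext1 x
    have hx := (EuclideanSpace.basisFun (Fin d) ℝ).sum_repr x
    conv_lhs => rw [← hx]
    rw [_root_.map_sum, _root_.sum_apply]
    refine Finset.sum_congr rfl fun i _ => ?_
    simp [basisVec]
  conv_lhs => rw [hL, ← alternatizeUncurryFinCLM_apply, _root_.map_sum]
  rfl

/-- Interior multiplication by the vector `e`. -/
def interior (e : Space d) : Form d (s + 1) →L[ℝ] Form d s :=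
  (ContinuousLinearMap.apply ℝ (Form d s) e).comp
    (curryLeftLI (𝕜 := ℝ) (E := Space d) (F := ℝ) (n := s)).toContinuousLinearMap

lemma interior_apply (e : Space d) (p : Form d (s + 1)) (v : Fin s → Space d) :
    interior e p v = p (Matrix.vecCons e v) := rfl

lemma norm_interior_le (e : Space d) (p : Form d (s + 1)) : ‖interior e p‖ ≤ ‖e‖ * ‖p‖ := by
  have h := (p.curryLeft).le_opNorm e
  rw [norm_curryLeft, mul_comm] at h
  exact h

/-- Cartan's formula for a constant field, `∂_e f = d(ι_e f) + ι_e(df)`, with `L = ∇f` and `df = 0`.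
Evaluating the alternatization of `L` at `(e, v)` gives `L e` at `v` minus the alternatization of
`ι_e ∘ L`. -/
lemma eq_alternatize_interior (L : Space d →L[ℝ] Form d (s + 1))
    (hL : alternatizeUncurryFin L = 0) (e : Space d) :
    alternatizeUncurryFin ((interior e).comp L) = L e := by
  ext v
  have h := congrArg (fun p => p (Matrix.vecCons e v)) hL
  simp only [alternatizeUncurryFin_apply] at h
  rw [Fin.sum_univ_succ] at h
  have h0 : Fin.removeNth 0 (Matrix.vecCons e v) = v := by ext; simp [Fin.removeNth]
  have hs : ∀ i : Fin (s + 1), Fin.removeNth i.succ (Matrix.vecCons e v) =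
      Matrix.vecCons e (Fin.removeNth i v) := by
    intro i
    ext j : 1
    refine Fin.cases ?_ (fun j => ?_) j <;> simp [Fin.removeNth]
  simp only [h0, hs] at h
  rw [alternatizeUncurryFin_apply]
  simp only [ContinuousLinearMap.comp_apply, interior_apply]
  simp [pow_succ] at h ⊢
  linarith

end

/-! ### Smooth solutions of the first-order system and the Caccioppoli inequality. -/

section

variable {d r q s : ℕ}

/-- A smooth form on `ℝ^d` that solves `df = 0` and `d(a f) = 0` classically on `V`. -/
structure IsSmoothSol (A : Form d (s + 1) →L[ℝ] Form d (s + 1) →L[ℝ] ℝ) (V : Set (Space d))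
    (f : Space d → Form d (s + 1)) : Prop where
  smooth : ContDiff ℝ ∞ f
  closed : ∀ x ∈ V, alternatizeUncurryFin (fderiv ℝ f x) = 0
  coclosed : ∀ x ∈ V, ∀ b : Form d s, ∑ i, A (fderiv ℝ f x (basisVec d i)) (dxWedge i b) = 0

/-- The derivative of `f` in the constant direction `e`. -/
def dirDeriv {F : Type*} [NormedAddCommGroup F] [NormedSpace ℝ F] (e : Space d)
    (f : Space d → F) (x : Space d) : F := fderiv ℝ f x e

section dirDeriv

variable {F : Type*} [NormedAddCommGroup F] [NormedSpace ℝ F]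

lemma ContDiff.dirDeriv {f : Space d → F} (hf : ContDiff ℝ ∞ f) (e : Space d) :
    ContDiff ℝ ∞ (dirDeriv e f) :=
  (hf.fderiv_right (by simp)).clm_apply contDiff_const

/-- Symmetry of the second derivative. It lets linear constraints on `∇f` be differentiated in the
direction `e`. -/
lemma fderiv_dirDeriv {f : Space d → F} (hf : ContDiff ℝ ∞ f) (e x : Space d) :
    fderiv ℝ (dirDeriv e f) x = fderiv ℝ (fderiv ℝ f) x e := by
  have h1 : DifferentiableAt ℝ (fderiv ℝ f) x :=
    ((hf.fderiv_right (m := ∞) (by simp)).differentiable (by simp)).differentiableAt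
  have h2 : IsSymmSndFDerivAt ℝ f x := hf.contDiffAt.isSymmSndFDerivAt (by
    simp only [minSmoothness_of_isRCLikeNormedField]
    exact WithTop.coe_le_coe.mpr le_top)
  ext1 w
  have := fderiv_clm_apply h1 (differentiableAt_const e)
  change fderiv ℝ (fun y => fderiv ℝ f y e) x w = _
  rw [this]
  simpa using h2 w e

lemma hasFDerivAt_clm_comp_fderiv {W : Type*} [NormedAddCommGroup W] [NormedSpace ℝ W]
    {f : Space d → F} (hf : ContDiff ℝ ∞ f) (x : Space d) (P : (Space d →L[ℝ] F) →L[ℝ] W) :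
    HasFDerivAt (P ∘ fderiv ℝ f) (P.comp (fderiv ℝ (fderiv ℝ f) x)) x :=
  P.hasFDerivAt.comp x (((hf.fderiv_right (m := ∞) (by simp)).differentiable
    (by simp)).differentiableAt).hasFDerivAt

lemma tsupport_dirDeriv_subset (f : Space d → F) (e : Space d) :
    tsupport (dirDeriv e f) ⊆ tsupport f :=
  (closure_mono fun x hx => by
    rw [Function.mem_support] at hx ⊢
    exact fun h => hx (by simp only [dirDeriv, h]; rfl)).trans
    (isClosed_tsupport _ |>.closure_subset_iff.mpr (support_fderiv_subset ℝ))

end dirDeriv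

namespace IsSmoothSol

variable {A : Form d (s + 1) →L[ℝ] Form d (s + 1) →L[ℝ] ℝ} {V : Set (Space d)}
  {f g : Space d → Form d (s + 1)}

lemma differentiableAt (hf : IsSmoothSol A V f) (x : Space d) : DifferentiableAt ℝ f x :=
  (hf.smooth.differentiable (by simp)).differentiableAt

lemma mono {W : Set (Space d)} (hf : IsSmoothSol A V f) (h : W ⊆ V) : IsSmoothSol A W f :=
  ⟨hf.smooth, fun x hx => hf.closed x (h hx), fun x hx => hf.coclosed x (h hx)⟩

lemma sub (hf : IsSmoothSol A V f) (hg : IsSmoothSol A V g) :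
    IsSmoothSol A V (fun x => f x - g x) := by
  have hd : ∀ x, fderiv ℝ (fun x => f x - g x) x = fderiv ℝ f x - fderiv ℝ g x := fun x =>
    fderiv_fun_sub (hf.differentiableAt x) (hg.differentiableAt x)
  refine ⟨hf.smooth.sub hg.smooth, fun x hx => ?_, fun x hx b => ?_⟩
  · have h1 := hf.closed x hx
    have h2 := hg.closed x hx
    rw [← alternatizeUncurryFinCLM_apply] at h1 h2 ⊢
    rw [hd, _root_.map_sub, h1, h2, sub_zero]
  · simp only [hd, _root_.sub_apply, _root_.map_sub, Finset.sum_sub_distrib, hf.coclosed x hx b,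
      hg.coclosed x hx b, sub_zero]

/-- Both equations say that a fixed linear map kills `∇f` throughout the open set `V`, so it also
kills the derivative of `∇f` in the direction `e`. -/
lemma dirDeriv (hV : IsOpen V) (hf : IsSmoothSol A V f) (e : Space d) :
    IsSmoothSol A V (dirDeriv e f) := by
  refine ⟨ContDiff.dirDeriv hf.smooth e, fun x hx => ?_, fun x hx b => ?_⟩
  · rw [fderiv_dirDeriv hf.smooth]
    have h1 := hasFDerivAt_clm_comp_fderiv hf.smooth x
      (alternatizeUncurryFinCLM ℝ (Space d) ℝ (n := s + 1))
    have h2 : HasFDerivAt ((alternatizeUncurryFinCLM ℝ (Space d) ℝ (n := s + 1)) ∘ fderiv ℝ f)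
        (0 : Space d →L[ℝ] _) x := by
      refine (hasFDerivAt_const 0 x).congr_of_eventuallyEq ?_
      filter_upwards [hV.mem_nhds hx] with y hy using hf.closed y hy
    have h3 := h1.unique h2
    exact congrArg (fun T => T e) h3
  · rw [fderiv_dirDeriv hf.smooth]
    set P : (Space d →L[ℝ] Form d (s + 1)) →L[ℝ] ℝ := ∑ i, (A.flip (dxWedge i b)).comp
      (ContinuousLinearMap.apply ℝ (Form d (s + 1)) (basisVec d i)) with hP
    have hPa : ∀ L, P L = ∑ i, A (L (basisVec d i)) (dxWedge i b) := by
      intro L; simp [hP]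
    have h1 := hasFDerivAt_clm_comp_fderiv hf.smooth x P
    have h2 : HasFDerivAt (P ∘ fderiv ℝ f) (0 : Space d →L[ℝ] _) x := by
      refine (hasFDerivAt_const 0 x).congr_of_eventuallyEq ?_
      filter_upwards [hV.mem_nhds hx] with y hy
      exact (hPa _).trans (hf.coclosed y hy b)
    have h3 := congrArg (fun T => T e) (h1.unique h2)
    rw [← hPa]
    exact h3

/-- Writing `dv = ∑ dx_i ∧ ∂_i v` and integrating by parts moves each `∂_i` onto `f`, where
`coclosed` applies. -/
lemma integral_eq_zero (hf : IsSmoothSol A V f) (v : Space d → Form d s) (hv : ContDiff ℝ ∞ v)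
    (hvc : HasCompactSupport v) (hvV : tsupport v ⊆ V) :
    ∫ x, A (f x) (extDeriv v x) = 0 := by
  have hv' : Continuous (fderiv ℝ v) := hv.continuous_fderiv (by simp)
  have hf' : Continuous (fderiv ℝ f) := hf.smooth.continuous_fderiv (by simp)
  set B : Fin d → Form d (s + 1) →L[ℝ] Form d s →L[ℝ] ℝ := fun i =>
    A.bilinearComp (ContinuousLinearMap.id ℝ _) ((alternatizeUncurryFinCLM ℝ (Space d) ℝ).comp
      (ContinuousLinearMap.smulRightL ℝ (Space d) (Form d s) (EuclideanSpace.proj i))) with hB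
  have hBa : ∀ i p b, B i p b = A p (dxWedge i b) := fun i p b => rfl
  have hvz : ∀ x ∉ tsupport v, v x = 0 := fun x hx => image_eq_zero_of_notMem_tsupport hx
  have hvz' : ∀ x ∉ tsupport v, fderiv ℝ v x = 0 := fun x hx =>
    image_eq_zero_of_notMem_tsupport fun h => hx (tsupport_fderiv_subset ℝ h)
  have hint1 : ∀ i, Integrable (fun x => B i (f x) (v x)) := fun i =>
    (((B i).continuous.comp hf.smooth.continuous).clm_apply hv.continuous
      ).integrable_of_hasCompactSupport
      (HasCompactSupport.intro hvc fun x hx => by simp [hvz x hx])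
  have hint2 : ∀ i, Integrable (fun x => B i (f x) (fderiv ℝ v x (basisVec d i))) := fun i =>
    (((B i).continuous.comp hf.smooth.continuous).clm_apply (hv'.clm_apply continuous_const)
      ).integrable_of_hasCompactSupport
      (HasCompactSupport.intro hvc fun x hx => by simp [hvz' x hx])
  have hint3 : ∀ i, Integrable (fun x => B i (fderiv ℝ f x (basisVec d i)) (v x)) := fun i =>
    (((B i).continuous.comp (hf'.clm_apply continuous_const)).clm_apply hv.continuous
      ).integrable_of_hasCompactSupport
      (HasCompactSupport.intro hvc fun x hx => by simp [hvz x hx])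
  have h1 : ∀ x, A (f x) (extDeriv v x) = ∑ i, B i (f x) (fderiv ℝ v x (basisVec d i)) := by
    intro x
    simp only [hBa, extDeriv, alternatize_eq_sum, _root_.map_sum]
  simp only [h1]
  rw [integral_finsetSum _ fun i _ => hint2 i]
  have h2 : ∀ i, ∫ x, B i (f x) (fderiv ℝ v x (basisVec d i)) =
      - ∫ x, B i (fderiv ℝ f x (basisVec d i)) (v x) := fun i =>
    integral_bilinear_fderiv_right_eq_neg_left_of_integrable (hint3 i) (hint2 i) (hint1 i)
      (fun x _ => hf.differentiableAt x)
      (fun x _ => (hv.differentiable (by simp)).differentiableAt)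
  simp only [h2, Finset.sum_neg_distrib]
  rw [← integral_finsetSum _ fun i _ => hint3 i, neg_eq_zero]
  rw [← integral_zero (Space d) ℝ]
  congr 1
  ext x
  by_cases hx : x ∈ tsupport v
  · exact hf.coclosed x (hvV hx) (v x)
  · simp [hvz x hx]

end IsSmoothSol

/-- The **Caccioppoli inequality**. -/
lemma exists_caccioppoli (d s : ℕ) {lam : ℝ} (hlam : 0 < lam) : ∃ C : ℝ, 0 < C ∧
    ∀ A : Form d (s + 1) →L[ℝ] Form d (s + 1) →L[ℝ] ℝ, IsEllipticForm lam A →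
    ∀ (V : Set (Space d)) (f : Space d → Form d (s + 1)), IsOpen V → IsSmoothSol A V f →
    ∀ η : Space d → ℝ, ContDiff ℝ ∞ η → HasCompactSupport η → tsupport η ⊆ V →
    ∀ e : Space d, ∫ x, η x ^ 2 * ‖dirDeriv e f x‖ ^ 2 ≤
      C * ‖e‖ ^ 2 * ∫ x, ‖fderiv ℝ η x‖ ^ 2 * ‖f x‖ ^ 2 := by
  obtain ⟨K, hK, hKn⟩ := norm_le_coeff d (s + 1)
  -- The ratio of `2K/λ` to `λ/(2K)` from absorption, times `(s + 1)²` from the norm of the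
  -- alternatization in `dη ∧ ι_e f`.
  refine ⟨4 * K ^ 2 * (s + 1) ^ 2 / lam ^ 2, by positivity, ?_⟩
  intro A hA V f hV hf η hη hηc hηV e
  have hg := hf.dirDeriv hV e
  set g := dirDeriv e f with hgdef
  set w : Space d → Form d (s + 1) := fun x =>
    alternatizeUncurryFin ((fderiv ℝ η x).smulRight (interior e (f x))) with hw
  set v : Space d → Form d s := fun x => η x ^ 2 • interior e (f x) with hv
  have hη' : Continuous (fderiv ℝ η) := hη.continuous_fderiv (by simp)
  have hvs : ContDiff ℝ ∞ v := (hη.pow 2).smul ((interior e).contDiff.comp hf.smooth)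
  have hηz : ∀ x ∉ tsupport η, η x = 0 := fun x hx => image_eq_zero_of_notMem_tsupport hx
  have hηz' : ∀ x ∉ tsupport η, fderiv ℝ η x = 0 := fun x hx =>
    image_eq_zero_of_notMem_tsupport fun h => hx (tsupport_fderiv_subset ℝ h)
  have hvt : tsupport v ⊆ tsupport η := by
    refine closure_minimal (fun x hx => ?_) (isClosed_tsupport _)
    by_contra h
    exact hx (by simp [hv, hηz x h])
  have hvc : HasCompactSupport v := HasCompactSupport.intro hηc fun x hx => by simp [hv, hηz x hx]
  have hvd : ∀ x, extDeriv v x = η x ^ 2 • g x + (2 * η x) • w x := by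
    intro x
    have h1 : HasFDerivAt v (η x ^ 2 • (interior e).comp (fderiv ℝ f x) +
        ((2 * η x) • fderiv ℝ η x).smulRight (interior e (f x))) x := by
      have hη1 : HasFDerivAt (fun y => η y ^ 2) ((2 * η x) • fderiv ℝ η x) x := by
        have := ((hη.differentiable (by simp)).differentiableAt (x := x)).hasFDerivAt.pow 2
        simpa using this
      exact hη1.smul ((interior e).hasFDerivAt.comp x (hf.differentiableAt x).hasFDerivAt)
    rw [extDeriv, h1.fderiv]
    have h2 : ((2 * η x) • fderiv ℝ η x).smulRight (interior e (f x)) =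
        (2 * η x) • (fderiv ℝ η x).smulRight (interior e (f x)) := by
      ext; simp [mul_assoc]
    rw [h2, ← alternatizeUncurryFinCLM_apply, _root_.map_add, _root_.map_smul, _root_.map_smul,
      alternatizeUncurryFinCLM_apply, alternatizeUncurryFinCLM_apply]
    congr 1
    -- Closedness of `f` is known only on `V`; off the support of `η` both sides vanish.
    by_cases hx : x ∈ tsupport η
    · rw [eq_alternatize_interior _ (hf.closed x (hηV hx))]; rfl
    · simp [hηz x hx]
  have hzero := hg.integral_eq_zero v hvs hvc (hvt.trans hηV)
  have hgc : Continuous g := hg.smooth.continuous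
  have hwc : Continuous w := by
    have : Continuous fun x => (fderiv ℝ η x).smulRight (interior e (f x)) :=
      ((ContinuousLinearMap.smulRightL ℝ (Space d) (Form d s)).continuous.comp hη').clm_apply
        ((interior e).continuous.comp hf.smooth.continuous)
    exact (alternatizeUncurryFinCLM ℝ (Space d) ℝ).continuous.comp this
  have hwn : ∀ x, ‖w x‖ ^ 2 ≤ (s + 1) ^ 2 * ‖e‖ ^ 2 * (‖fderiv ℝ η x‖ ^ 2 * ‖f x‖ ^ 2) := by
    intro x
    have h1 : ‖w x‖ ≤ (s + 1) * (‖fderiv ℝ η x‖ * (‖e‖ * ‖f x‖)) := by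
      refine (norm_alternatizeUncurryFin_le _).trans ?_
      rw [ContinuousLinearMap.norm_smulRight_apply]
      gcongr
      exact norm_interior_le e _
    calc ‖w x‖ ^ 2 ≤ ((s + 1) * (‖fderiv ℝ η x‖ * (‖e‖ * ‖f x‖))) ^ 2 := by gcongr
      _ = _ := by ring
  have hpt : ∀ x, lam / (2 * K) * (η x ^ 2 * ‖g x‖ ^ 2) -
      2 * K / lam * ((s + 1) ^ 2 * ‖e‖ ^ 2) * (‖fderiv ℝ η x‖ ^ 2 * ‖f x‖ ^ 2) ≤
      A (g x) (extDeriv v x) := by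
    intro x
    -- Positivity of `A` on `ηg + 2w` is Young's inequality in disguise: the cross term `2η A(g, w)`
    -- is at least `-½ η² A(g, g) - 2 A(w, w)`.
    have h1 : 0 ≤ A (η x • g x + (2 : ℝ) • w x) (η x • g x + (2 : ℝ) • w x) :=
      le_trans (mul_nonneg hlam.le (Finset.sum_nonneg fun _ _ => sq_nonneg _)) (hA.lower _)
    have h2 : A (η x • g x + (2 : ℝ) • w x) (η x • g x + (2 : ℝ) • w x) =
        η x ^ 2 * A (g x) (g x) + 4 * η x * A (g x) (w x) + 4 * A (w x) (w x) := by
      simp only [_root_.map_add, _root_.map_smul, _root_.add_apply, _root_.smul_apply, smul_eq_mul,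
        hA.symm (w x) (g x)]
      ring
    have h3 : A (g x) (extDeriv v x) = η x ^ 2 * A (g x) (g x) + 2 * η x * A (g x) (w x) := by
      rw [hvd]
      simp only [_root_.map_add, _root_.map_smul, smul_eq_mul]
    have h4 : lam / K * ‖g x‖ ^ 2 ≤ A (g x) (g x) := by
      refine le_trans ?_ (hA.lower _)
      rw [div_mul_eq_mul_div, div_le_iff₀ hK]
      have := (hKn (g x)).2.1
      nlinarith
    have h5 : A (w x) (w x) ≤ K / lam * ((s + 1) ^ 2 * ‖e‖ ^ 2 *
        (‖fderiv ℝ η x‖ ^ 2 * ‖f x‖ ^ 2)) := by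
      refine (hA.upper _).trans ?_
      have h6 := (hKn (w x)).2.2.trans (mul_le_mul_of_nonneg_left (hwn x) hK.le)
      calc 1 / lam * normSq (w x) ≤ 1 / lam * (K * ((s + 1) ^ 2 * ‖e‖ ^ 2 *
          (‖fderiv ℝ η x‖ ^ 2 * ‖f x‖ ^ 2))) := by gcongr
        _ = _ := by ring
    have h7 : η x ^ 2 * (lam / K * ‖g x‖ ^ 2) ≤ η x ^ 2 * A (g x) (g x) := by gcongr
    have h8 : lam / (2 * K) * (η x ^ 2 * ‖g x‖ ^ 2) = 1 / 2 * (η x ^ 2 * (lam / K * ‖g x‖ ^ 2)) := by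
      field_simp
    have h9 : 2 * K / lam * ((s + 1) ^ 2 * ‖e‖ ^ 2) * (‖fderiv ℝ η x‖ ^ 2 * ‖f x‖ ^ 2) =
        2 * (K / lam * ((s + 1) ^ 2 * ‖e‖ ^ 2 * (‖fderiv ℝ η x‖ ^ 2 * ‖f x‖ ^ 2))) := by ring
    rw [h8, h9]
    linarith
  have hi1 : Integrable fun x => η x ^ 2 * ‖g x‖ ^ 2 :=
    ((hη.continuous.pow 2).mul (hgc.norm.pow 2)).integrable_of_hasCompactSupport
      (HasCompactSupport.intro hηc fun x hx => by simp [hηz x hx])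
  have hi2 : Integrable fun x => ‖fderiv ℝ η x‖ ^ 2 * ‖f x‖ ^ 2 :=
    ((hη'.norm.pow 2).mul (hf.smooth.continuous.norm.pow 2)).integrable_of_hasCompactSupport
      (HasCompactSupport.intro hηc fun x hx => by simp [hηz' x hx])
  have hi3 : Integrable fun x => A (g x) (extDeriv v x) := by
    simp only [hvd]
    refine Continuous.integrable_of_hasCompactSupport ?_
      (HasCompactSupport.intro hηc fun x hx => by simp [hηz x hx])
    have hc := hη.continuous
    exact (A.continuous.comp hgc).clm_apply (by fun_prop)
  have hfin := integral_mono ((hi1.const_mul (lam / (2 * K))).sub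
    (hi2.const_mul (2 * K / lam * ((s + 1) ^ 2 * ‖e‖ ^ 2)))) hi3 hpt
  simp only [Pi.sub_apply] at hfin
  rw [hzero, integral_sub (hi1.const_mul _) (hi2.const_mul _), integral_const_mul,
    integral_const_mul, sub_nonpos] at hfin
  have h10 : ∀ x y : ℝ, lam / (2 * K) * x ≤ 2 * K / lam * ((s + 1) ^ 2 * ‖e‖ ^ 2) * y →
      x ≤ 4 * K ^ 2 * (s + 1) ^ 2 / lam ^ 2 * ‖e‖ ^ 2 * y := by
    intro x y hxy
    have := mul_le_mul_of_nonneg_left hxy (show 0 ≤ 2 * K / lam by positivity)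
    calc x = 2 * K / lam * (lam / (2 * K) * x) := by field_simp
      _ ≤ _ := this
      _ = _ := by field_simp; ring
  exact h10 _ _ hfin

end

/-! ### Iterated partial derivatives, an elementary Sobolev inequality and Cauchy–Schwarz on balls.
-/

section

variable {d s : ℕ}

section iteratedPartial

variable {F : Type*} [NormedAddCommGroup F] [NormedSpace ℝ F]

/-- The iterated partial derivative of `f` along a list of coordinate directions. -/
def partials : List (Fin d) → (Space d → F) → Space d → F
  | [], f => f
  | i :: l, f => partials l (dirDeriv (basisVec d i) f)

lemma partials_append (l l' : List (Fin d)) (f : Space d → F) :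
    partials (l ++ l') f = partials l' (partials l f) := by
  induction l generalizing f with
  | nil => rfl
  | cons i l ih => exact ih _

lemma ContDiff.partials {f : Space d → F} (hf : ContDiff ℝ ∞ f) (l : List (Fin d)) :
    ContDiff ℝ ∞ (partials l f) := by
  induction l generalizing f with
  | nil => exact hf
  | cons i l ih => exact ih (ContDiff.dirDeriv hf _)

lemma tsupport_partials_subset (f : Space d → F) (l : List (Fin d)) :
    tsupport (partials l f) ⊆ tsupport f := by
  induction l generalizing f with
  | nil => exact subset_rfl
  | cons i l ih => exact (ih _).trans (tsupport_dirDeriv_subset f _)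

lemma HasCompactSupport.partials {f : Space d → F} (hf : HasCompactSupport f)
    (l : List (Fin d)) : HasCompactSupport (partials l f) :=
  hf.of_isClosed_subset (isClosed_tsupport _) (tsupport_partials_subset f l)

lemma partials_add {f g : Space d → F} (hf : ContDiff ℝ ∞ f) (hg : ContDiff ℝ ∞ g)
    (l : List (Fin d)) :
    partials l (fun x => f x + g x) = fun x => partials l f x + partials l g x := by
  induction l generalizing f g with
  | nil => rfl
  | cons i l ih =>
    rw [partials, partials, partials, ← ih (ContDiff.dirDeriv hf _) (ContDiff.dirDeriv hg _)]
    congr 1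
    ext1 x
    simp only [dirDeriv]
    rw [fderiv_fun_add (hf.differentiable (by simp)).differentiableAt
      (hg.differentiable (by simp)).differentiableAt]
    rfl

lemma partials_sub {f g : Space d → F} (hf : ContDiff ℝ ∞ f) (hg : ContDiff ℝ ∞ g)
    (l : List (Fin d)) :
    partials l (fun x => f x - g x) = fun x => partials l f x - partials l g x := by
  induction l generalizing f g with
  | nil => rfl
  | cons i l ih =>
    rw [partials, partials, partials, ← ih (ContDiff.dirDeriv hf _) (ContDiff.dirDeriv hg _)]
    congr 1
    ext1 x
    simp only [dirDeriv]
    rw [fderiv_fun_sub (hf.differentiable (by simp)).differentiableAt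
      (hg.differentiable (by simp)).differentiableAt]
    rfl

lemma partials_congr {f g : Space d → F} {x : Space d} (h : f =ᶠ[nhds x] g) (l : List (Fin d)) :
    partials l f x = partials l g x := by
  induction l generalizing f g with
  | nil => exact h.eq_of_nhds
  | cons i l ih =>
    refine ih ?_
    filter_upwards [h.fderiv (𝕜 := ℝ)] with y hy
    simp only [dirDeriv, hy]

lemma partials_comp_affine {f : Space d → F} (hf : ContDiff ℝ ∞ f) (x₀ : Space d) (t : ℝ)
    (l : List (Fin d)) :
    partials l (fun y => f (x₀ + t • y)) = fun y => t ^ l.length • partials l f (x₀ + t • y) := by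
  suffices h : ∀ c : ℝ, partials l (fun y => c • f (x₀ + t • y)) =
      fun y => (c * t ^ l.length) • partials l f (x₀ + t • y) by
    simpa using h 1
  induction l generalizing f with
  | nil => intro c; simp [partials]
  | cons i l ih =>
    intro c
    have h1 : dirDeriv (basisVec d i) (fun y => c • f (x₀ + t • y)) =
        fun y => (c * t) • dirDeriv (basisVec d i) f (x₀ + t • y) := by
      ext1 y
      have h2 : HasFDerivAt (fun y : Space d => x₀ + t • y)
          (t • ContinuousLinearMap.id ℝ (Space d)) y :=
        ((hasFDerivAt_id y).const_smul t).const_add x₀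
      have h3 := ((hf.differentiable (by simp)).differentiableAt
        (x := x₀ + t • y)).hasFDerivAt.comp y h2
      have h4 := (h3.const_smul c).fderiv
      simp only [dirDeriv]
      change fderiv ℝ (c • (f ∘ fun y => x₀ + t • y)) y _ = _
      rw [h4]
      simp [smul_smul]
    rw [partials, h1, ih (ContDiff.dirDeriv hf _)]
    simp only [partials, List.length_cons]
    ext1 y
    congr 1
    ring

/-- The fundamental theorem of calculus along the `i`-th coordinate line, starting from where `f`
vanishes. -/
lemma enorm_le_lintegral_dirDeriv {f : Space d → F} (hf : ContDiff ℝ ∞ f)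
    (hfc : HasCompactSupport f) (x : Fin d → ℝ) (i : Fin d) :
    ‖f (WithLp.toLp 2 x)‖ₑ ≤
      ∫⁻ t, ‖dirDeriv (basisVec d i) f (WithLp.toLp 2 (Function.update x i t))‖ₑ := by
  set e := (PiLp.continuousLinearEquiv 2 ℝ (fun _ : Fin d => ℝ)).symm with he
  set g : ℝ → F := f ∘ e ∘ Function.update x i with hg
  have hgs : ContDiff ℝ 1 g :=
    (hf.of_le (by simp)).comp (e.contDiff.comp (contDiff_update 1 x i))
  have hgc : HasCompactSupport g :=
    hfc.comp_isClosedEmbedding (e.toHomeomorph.isClosedEmbedding.comp (isClosedEmbedding_update x i))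
  have hd : ∀ t, deriv g t =
      dirDeriv (basisVec d i) f (WithLp.toLp 2 (Function.update x i t)) := by
    intro t
    have h1 : HasDerivAt (e ∘ Function.update x i) (e (Pi.single i 1)) t :=
      e.hasFDerivAt.comp_hasDerivAt t (hasDerivAt_update x i t)
    exact (((hf.differentiable (by simp)).differentiableAt
      (x := e (Function.update x i t))).hasFDerivAt.comp_hasDerivAt t h1).deriv
  have h2 := hgc.enorm_le_lintegral_Ici_deriv hgs (x i)
  calc ‖f (WithLp.toLp 2 x)‖ₑ = ‖g (x i)‖ₑ := by simp [hg, he]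
    _ ≤ ∫⁻ y in Set.Iic (x i), ‖deriv g y‖ₑ := h2
    _ ≤ ∫⁻ y, ‖deriv g y‖ₑ := lintegral_mono' Measure.restrict_le_self le_rfl
    _ = _ := by simp only [hd]

/-- Each direction in the list costs one derivative and one integration. Distinctness ensures that
every variable is integrated out only once. -/
lemma enorm_le_lmarginal_partials {f : Space d → F} (hf : ContDiff ℝ ∞ f)
    (hfc : HasCompactSupport f) (l : List (Fin d)) (hl : l.Nodup) (x : Fin d → ℝ) :
    ‖f (WithLp.toLp 2 x)‖ₑ ≤
      (∫⋯∫⁻_l.toFinset, (fun y => ‖partials l f (WithLp.toLp 2 y)‖ₑ)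
        ∂(fun _ : Fin d => (volume : Measure ℝ))) x := by
  induction l generalizing f x with
  | nil => simp [partials]
  | cons i l ih =>
    rw [List.nodup_cons] at hl
    have hm : Measurable fun y : Fin d → ℝ => ‖partials (i :: l) f (WithLp.toLp 2 y)‖ₑ :=
      ((ContDiff.partials hf _).continuous.comp (PiLp.continuous_toLp 2 _)).enorm.measurable
    rw [List.toFinset_cons, lmarginal_insert _ hm (by simpa using hl.1)]
    refine (enorm_le_lintegral_dirDeriv hf hfc x i).trans ?_
    refine lintegral_mono fun t => ?_
    exact ih (ContDiff.dirDeriv hf _)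
      (hfc.of_isClosed_subset (isClosed_tsupport _) (tsupport_dirDeriv_subset f _)) hl.2 _

/-- A smooth compactly supported function is bounded by the integral of `|∂_1 ⋯ ∂_d f|`. -/
lemma norm_le_integral_partials {f : Space d → F} (hf : ContDiff ℝ ∞ f)
    (hfc : HasCompactSupport f) (x : Space d) :
    ‖f x‖ ≤ ∫ y, ‖partials (List.finRange d) f y‖ := by
  have h1 := enorm_le_lmarginal_partials hf hfc (List.finRange d) (List.nodup_finRange d)
    (WithLp.ofLp x)
  have hu : (List.finRange d).toFinset = Finset.univ := by ext; simp
  have hc := (ContDiff.partials hf (List.finRange d)).continuous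
  rw [hu, lmarginal_univ] at h1
  have h2 : ∫⁻ y, ‖partials (List.finRange d) f (WithLp.toLp 2 y)‖ₑ ∂(Measure.pi fun _ => volume) =
      ∫⁻ y, ‖partials (List.finRange d) f y‖ₑ :=
    (PiLp.volume_preserving_toLp (Fin d)).lintegral_comp hc.enorm.measurable
  rw [h2] at h1
  have hi : Integrable (partials (List.finRange d) f) :=
    hc.integrable_of_hasCompactSupport (HasCompactSupport.partials hfc _)
  rw [integral_norm_eq_lintegral_enorm hi.1]
  have := ENNReal.toReal_mono hi.2.ne h1
  simpa using this

end iteratedPartial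

/-- Cauchy–Schwarz, obtained from the nonnegativity of the variance of `‖f‖` on the ball. -/
lemma sq_setIntegral_norm_le {F : Type*} [NormedAddCommGroup F] {f : Space d → F}
    (hf : Continuous f) (x₀ : Space d) {ρ : ℝ} (hρ : 0 < ρ) :
    (∫ x in Metric.ball x₀ ρ, ‖f x‖) ^ 2 ≤
      volume.real (Metric.ball x₀ ρ) * ∫ x in Metric.ball x₀ ρ, ‖f x‖ ^ 2 := by
  set μ := volume.restrict (Metric.ball x₀ ρ) with hμ
  set m := volume.real (Metric.ball x₀ ρ) with hm
  have hm0 : 0 < m := by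
    rw [hm, measureReal_def]
    exact ENNReal.toReal_pos (Metric.measure_ball_pos _ _ hρ).ne' measure_ball_lt_top.ne
  have hint : ∀ g : Space d → ℝ, Continuous g → Integrable g μ := fun g hg =>
    (hg.continuousOn.integrableOn_compact (isCompact_closedBall x₀ ρ)).mono_set
      Metric.ball_subset_closedBall
  set a := ∫ x in Metric.ball x₀ ρ, ‖f x‖ with ha
  have h0 : 0 ≤ ∫ x, (‖f x‖ - a / m) ^ 2 ∂μ := integral_nonneg fun _ => sq_nonneg _
  have h1 : ∫ x, (‖f x‖ - a / m) ^ 2 ∂μ = (∫ x, ‖f x‖ ^ 2 ∂μ) - a ^ 2 / m := by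
    have : ∀ x, (‖f x‖ - a / m) ^ 2 = (‖f x‖ ^ 2 - 2 * (a / m) * ‖f x‖) + (a / m) ^ 2 := by
      intro x; ring
    simp only [this]
    have hi1 : Integrable (fun x => ‖f x‖ ^ 2) μ := hint _ (hf.norm.pow 2)
    have hi2 : Integrable (fun x => 2 * (a / m) * ‖f x‖) μ := (hint _ hf.norm).const_mul _
    have hi3 : Integrable (fun x => ‖f x‖ ^ 2 - 2 * (a / m) * ‖f x‖) μ := hi1.sub hi2
    rw [integral_add hi3 (hint _ continuous_const), integral_sub hi1 hi2, integral_const_mul,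
      integral_const]
    have hmm : μ.real Set.univ = m := by simp [hμ, hm, measureReal_def]
    rw [hmm, ← ha, smul_eq_mul]
    field_simp
    ring
  rw [h1, sub_nonneg, div_le_iff₀ hm0] at h0
  linarith

end

/-! ### Iterating the Caccioppoli inequality; the scaled interior estimate. -/

section

variable {d s : ℕ}

lemma integrableOn_ball {E : Type*} [NormedAddCommGroup E] {g : Space d → E} (hg : Continuous g)
    (x₀ : Space d) (ρ : ℝ) : IntegrableOn g (Metric.ball x₀ ρ) :=
  (hg.continuousOn.integrableOn_compact (isCompact_closedBall x₀ ρ)).mono_set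
    Metric.ball_subset_closedBall

lemma integral_eq_setIntegral_ball {E : Type*} [NormedAddCommGroup E] [NormedSpace ℝ E]
    {g : Space d → E} {x₀ : Space d} {ρ : ℝ} (h : ∀ x ∉ Metric.ball x₀ ρ, g x = 0) :
    ∫ x, g x = ∫ x in Metric.ball x₀ ρ, g x :=
  (setIntegral_eq_integral_of_forall_compl_eq_zero h).symm

lemma exists_caccioppoli_ball (d s : ℕ) {lam : ℝ} (hlam : 0 < lam) {ρ ρ' : ℝ} (hρ : 0 < ρ)
    (hρ' : ρ < ρ') : ∃ C : ℝ, 0 < C ∧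
    ∀ A : Form d (s + 1) →L[ℝ] Form d (s + 1) →L[ℝ] ℝ, IsEllipticForm lam A →
    ∀ f : Space d → Form d (s + 1), IsSmoothSol A (Metric.ball 0 ρ') f → ∀ i : Fin d,
      ∫ x in Metric.ball 0 ρ, ‖dirDeriv (basisVec d i) f x‖ ^ 2 ≤
        C * ∫ x in Metric.ball 0 ρ', ‖f x‖ ^ 2 := by
  obtain ⟨C, hC, H⟩ := exists_caccioppoli d s hlam
  let η : ContDiffBump (0 : Space d) := ⟨ρ, (ρ + ρ') / 2, hρ, by linarith⟩
  have hηs : ContDiff ℝ ∞ η := η.contDiff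
  have hηt : tsupport η ⊆ Metric.ball 0 ρ' := by
    rw [η.tsupport_eq]
    exact Metric.closedBall_subset_ball (by change (ρ + ρ') / 2 < ρ'; linarith)
  have hη' : Continuous (fderiv ℝ η) := hηs.continuous_fderiv (by simp)
  obtain ⟨M, hM⟩ := (η.hasCompactSupport.fderiv (𝕜 := ℝ)).exists_bound_of_continuous hη'
  refine ⟨C * (M ^ 2 + 1), by positivity, fun A hA f hf i => ?_⟩
  have h := H A hA _ f Metric.isOpen_ball hf η hηs η.hasCompactSupport hηt (basisVec d i)
  rw [norm_basisVec, one_pow, mul_one] at h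
  have hgc : Continuous (dirDeriv (basisVec d i) f) := (ContDiff.dirDeriv hf.smooth _).continuous
  have hfc := hf.smooth.continuous
  have h1 : ∫ x in Metric.ball 0 ρ, ‖dirDeriv (basisVec d i) f x‖ ^ 2 ≤
      ∫ x, η x ^ 2 * ‖dirDeriv (basisVec d i) f x‖ ^ 2 := by
    have hi : Integrable fun x => η x ^ 2 * ‖dirDeriv (basisVec d i) f x‖ ^ 2 :=
      ((hηs.continuous.pow 2).mul (hgc.norm.pow 2)).integrable_of_hasCompactSupport
        (HasCompactSupport.intro η.hasCompactSupport fun x hx => by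
          simp [image_eq_zero_of_notMem_tsupport hx])
    calc _ = ∫ x in Metric.ball 0 ρ, η x ^ 2 * ‖dirDeriv (basisVec d i) f x‖ ^ 2 := by
          refine setIntegral_congr_fun measurableSet_ball fun x hx => ?_
          rw [η.one_of_mem_closedBall (Metric.ball_subset_closedBall hx)]
          ring
      _ ≤ _ := setIntegral_le_integral hi (Filter.Eventually.of_forall fun x => by positivity)
  have h2 : ∫ x, ‖fderiv ℝ η x‖ ^ 2 * ‖f x‖ ^ 2 ≤
      (M ^ 2 + 1) * ∫ x in Metric.ball 0 ρ', ‖f x‖ ^ 2 := by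
    rw [integral_eq_setIntegral_ball (x₀ := 0) (ρ := ρ') fun x hx => ?_, ← integral_const_mul]
    · refine setIntegral_mono_on (integrableOn_ball ((hη'.norm.pow 2).mul (hfc.norm.pow 2)) _ _)
        ((integrableOn_ball (hfc.norm.pow 2) _ _).const_mul _) measurableSet_ball fun x _ => ?_
      have := hM x
      have h3 : ‖fderiv ℝ η x‖ ^ 2 ≤ M ^ 2 := by gcongr
      gcongr
      linarith
    · rw [image_eq_zero_of_notMem_tsupport
        fun hx' => hx (hηt (tsupport_fderiv_subset ℝ hx'))]
      simp
  calc _ ≤ _ := h1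
    _ ≤ _ := h
    _ ≤ C * ((M ^ 2 + 1) * ∫ x in Metric.ball 0 ρ', ‖f x‖ ^ 2) := by gcongr
    _ = _ := by ring

/-- Induction over all radii and cutoffs at once. In `∂_i(χf) = (∂_i χ) f + χ ∂_i f` the first term
has the new cutoff `∂_i χ`; the second has the new solution `∂_i f` on an intermediate ball, where
Caccioppoli returns to `f`. The left side is an `L¹` norm because the Sobolev inequality asks for
one. -/
lemma exists_partials_smul_bound (d s : ℕ) {lam : ℝ} (hlam : 0 < lam) (l : List (Fin d)) :
    ∀ {ρ ρ' : ℝ}, 0 < ρ → ρ < ρ' → ∀ χ : Space d → ℝ, ContDiff ℝ ∞ χ → HasCompactSupport χ →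
    tsupport χ ⊆ Metric.ball 0 ρ → ∃ C : ℝ, 0 < C ∧
    ∀ A : Form d (s + 1) →L[ℝ] Form d (s + 1) →L[ℝ] ℝ, IsEllipticForm lam A →
    ∀ f : Space d → Form d (s + 1), IsSmoothSol A (Metric.ball 0 ρ') f →
      (∫ x, ‖partials l (fun y => χ y • f y) x‖) ^ 2 ≤
        C * ∫ x in Metric.ball 0 ρ', ‖f x‖ ^ 2 := by
  induction l with
  | nil =>
    intro ρ ρ' hρ hρ' χ hχ hχc hχt
    obtain ⟨M, hM⟩ := hχc.exists_bound_of_continuous hχ.continuous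
    have hM0 : 0 ≤ M := (norm_nonneg _).trans (hM 0)
    refine ⟨(M ^ 2) * volume.real (Metric.ball (0 : Space d) ρ') + 1, by positivity,
      fun A hA f hf => ?_⟩
    have hfc := hf.smooth.continuous
    have h1 : ∫ x, ‖partials [] (fun y => χ y • f y) x‖ ≤
        M * ∫ x in Metric.ball 0 ρ', ‖f x‖ := by
      simp only [partials]
      rw [integral_eq_setIntegral_ball (x₀ := 0) (ρ := ρ') fun x hx => ?_, ← integral_const_mul]
      · refine setIntegral_mono_on (integrableOn_ball (hχ.continuous.smul hfc).norm _ _)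
          ((integrableOn_ball hfc.norm _ _).const_mul _) measurableSet_ball fun x _ => ?_
        rw [norm_smul]
        gcongr
        exact hM x
      · rw [image_eq_zero_of_notMem_tsupport
          fun hx' => hx (Metric.ball_subset_ball hρ'.le (hχt hx'))]
        simp
    have h0 : 0 ≤ ∫ x, ‖partials [] (fun y => χ y • f y) x‖ := integral_nonneg fun _ => norm_nonneg _
    have hI : 0 ≤ ∫ x in Metric.ball 0 ρ', ‖f x‖ ^ 2 := integral_nonneg fun _ => by positivity
    calc _ ≤ (M * ∫ x in Metric.ball 0 ρ', ‖f x‖) ^ 2 := by gcongr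
      _ = M ^ 2 * (∫ x in Metric.ball 0 ρ', ‖f x‖) ^ 2 := by ring
      _ ≤ M ^ 2 * (volume.real (Metric.ball (0 : Space d) ρ') *
          ∫ x in Metric.ball 0 ρ', ‖f x‖ ^ 2) := by
        gcongr
        exact sq_setIntegral_norm_le hfc 0 (hρ.trans hρ')
      _ ≤ _ := by linarith
  | cons i l ih =>
    intro ρ ρ' hρ hρ' χ hχ hχc hχt
    have hm1 : ρ < (ρ + ρ') / 2 := by linarith
    have hm2 : (ρ + ρ') / 2 < ρ' := by linarith
    have hχ't := tsupport_dirDeriv_subset χ (basisVec d i)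
    obtain ⟨C₁, hC₁, H₁⟩ := ih hρ hρ' (dirDeriv (basisVec d i) χ) (ContDiff.dirDeriv hχ _)
      (hχc.of_isClosed_subset (isClosed_tsupport _) hχ't) (hχ't.trans hχt)
    obtain ⟨C₂, hC₂, H₂⟩ := ih hρ hm1 χ hχ hχc hχt
    obtain ⟨C₃, hC₃, H₃⟩ := exists_caccioppoli_ball d s hlam (hρ.trans hm1) hm2
    refine ⟨2 * C₁ + 2 * (C₂ * C₃), by positivity, fun A hA f hf => ?_⟩
    have hg := (hf.mono (Metric.ball_subset_ball hm2.le)).dirDeriv Metric.isOpen_ball (basisVec d i)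
    have hsplit : partials (i :: l) (fun y => χ y • f y) = fun x =>
        partials l (fun y => dirDeriv (basisVec d i) χ y • f y) x +
          partials l (fun y => χ y • dirDeriv (basisVec d i) f y) x := by
      have hadd := partials_add (f := fun y => dirDeriv (basisVec d i) χ y • f y)
        (g := fun y => χ y • dirDeriv (basisVec d i) f y)
        ((ContDiff.dirDeriv hχ _).smul hf.smooth) (hχ.smul hg.smooth) l
      rw [← hadd, partials]
      congr 1
      ext1 x
      simp only [dirDeriv]
      rw [fderiv_fun_smul (hχ.differentiable (by simp)).differentiableAt (hf.differentiableAt x)]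
      exact add_comm _ _
    have hs1 : Integrable (partials l (fun y => dirDeriv (basisVec d i) χ y • f y)) := by
      refine (ContDiff.partials ((ContDiff.dirDeriv hχ _).smul hf.smooth) l).continuous
        |>.integrable_of_hasCompactSupport (HasCompactSupport.partials ?_ l)
      exact HasCompactSupport.smul_right
        (hχc.of_isClosed_subset (isClosed_tsupport _) hχ't)
    have hs2 : Integrable (partials l (fun y => χ y • dirDeriv (basisVec d i) f y)) :=
      (ContDiff.partials (hχ.smul hg.smooth) l).continuous
        |>.integrable_of_hasCompactSupport (HasCompactSupport.partials hχc.smul_right l)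
    have h1 := H₁ A hA f hf
    have h2 := (H₂ A hA _ hg).trans (mul_le_mul_of_nonneg_left (H₃ A hA f hf i) hC₂.le)
    have h3 : ∫ x, ‖partials (i :: l) (fun y => χ y • f y) x‖ ≤
        (∫ x, ‖partials l (fun y => dirDeriv (basisVec d i) χ y • f y) x‖) +
          ∫ x, ‖partials l (fun y => χ y • dirDeriv (basisVec d i) f y) x‖ := by
      rw [← integral_add hs1.norm hs2.norm, hsplit]
      exact integral_mono (hs1.add hs2).norm (hs1.norm.add hs2.norm) fun x => norm_add_le _ _
    have h0 : 0 ≤ ∫ x, ‖partials (i :: l) (fun y => χ y • f y) x‖ :=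
      integral_nonneg fun _ => norm_nonneg _
    set a := ∫ x, ‖partials l (fun y => dirDeriv (basisVec d i) χ y • f y) x‖
    set b := ∫ x, ‖partials l (fun y => χ y • dirDeriv (basisVec d i) f y) x‖
    calc _ ≤ (a + b) ^ 2 := by gcongr
      _ ≤ 2 * a ^ 2 + 2 * b ^ 2 := by nlinarith [sq_nonneg (a - b)]
      _ ≤ _ := by linarith

/-- A cutoff equal to `1` near the origin does not change derivatives there. The list `l ++
List.finRange d` adds to `l` the `d` derivatives spent on the Sobolev inequality. -/
lemma exists_partials_bound_unit (d s : ℕ) {lam : ℝ} (hlam : 0 < lam) (l : List (Fin d)) :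
    ∃ C : ℝ, 0 < C ∧
    ∀ A : Form d (s + 1) →L[ℝ] Form d (s + 1) →L[ℝ] ℝ, IsEllipticForm lam A →
    ∀ f : Space d → Form d (s + 1), IsSmoothSol A (Metric.ball 0 1) f →
      ‖partials l f 0‖ ^ 2 ≤ C * ∫ x in Metric.ball 0 1, ‖f x‖ ^ 2 := by
  let χ : ContDiffBump (0 : Space d) := ⟨1 / 4, 1 / 3, by norm_num, by norm_num⟩
  have hχs : ContDiff ℝ ∞ χ := χ.contDiff
  have hχt : tsupport χ ⊆ Metric.ball 0 (1 / 2) := by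
    rw [χ.tsupport_eq]
    exact Metric.closedBall_subset_ball (by change (1 / 3 : ℝ) < 1 / 2; norm_num)
  obtain ⟨C, hC, H⟩ := exists_partials_smul_bound d s hlam (l ++ List.finRange d)
    (ρ := 1 / 2) (ρ' := 1) (by norm_num) (by norm_num) χ hχs χ.hasCompactSupport hχt
  refine ⟨C, hC, fun A hA f hf => le_trans ?_ (H A hA f hf)⟩
  have h1 : partials l f 0 = partials l (fun y => χ y • f y) 0 := by
    refine partials_congr ?_ l
    filter_upwards [χ.eventuallyEq_one] with y hy
    simp [hy]
  have hs : ContDiff ℝ ∞ fun y => χ y • f y := hχs.smul hf.smooth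
  rw [h1, partials_append]
  gcongr
  exact norm_le_integral_partials (ContDiff.partials hs l)
    (HasCompactSupport.partials χ.hasCompactSupport.smul_right l) 0

lemma IsSmoothSol.comp_affine {A : Form d (s + 1) →L[ℝ] Form d (s + 1) →L[ℝ] ℝ} {x₀ : Space d}
    {ρ : ℝ} (hρ : 0 < ρ) {f : Space d → Form d (s + 1)}
    (hf : IsSmoothSol A (Metric.ball x₀ ρ) f) :
    IsSmoothSol A (Metric.ball 0 1) fun y => f (x₀ + ρ • y) := by
  have hd : ∀ y, fderiv ℝ (fun y => f (x₀ + ρ • y)) y = ρ • fderiv ℝ f (x₀ + ρ • y) := by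
    intro y
    have h2 : HasFDerivAt (fun y : Space d => x₀ + ρ • y)
        (ρ • ContinuousLinearMap.id ℝ (Space d)) y :=
      ((hasFDerivAt_id y).const_smul ρ).const_add x₀
    have h3 := ((hf.differentiableAt (x₀ + ρ • y)).hasFDerivAt.comp y h2).fderiv
    change fderiv ℝ (f ∘ fun y => x₀ + ρ • y) y = _
    rw [h3]
    ext1 w
    simp
  have hm : ∀ y ∈ Metric.ball (0 : Space d) 1, x₀ + ρ • y ∈ Metric.ball x₀ ρ := by
    intro y hy
    rw [mem_ball_zero_iff] at hy
    rw [mem_ball_iff_norm, add_sub_cancel_left, norm_smul, Real.norm_of_nonneg hρ.le]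
    nlinarith
  refine ⟨hf.smooth.comp (contDiff_const.add (contDiff_id.const_smul ρ)), fun y hy => ?_,
    fun y hy b => ?_⟩
  · rw [hd, ← alternatizeUncurryFinCLM_apply, _root_.map_smul, alternatizeUncurryFinCLM_apply,
      hf.closed _ (hm y hy), smul_zero]
  · simp only [hd, _root_.smul_apply, _root_.map_smul, ← Finset.smul_sum,
      hf.coclosed _ (hm y hy) b, smul_zero]

/-- **Interior estimate** for smooth solutions on a ball. -/
lemma exists_partials_bound (d s : ℕ) {lam : ℝ} (hlam : 0 < lam) (l : List (Fin d)) :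
    ∃ C : ℝ, 0 < C ∧
    ∀ A : Form d (s + 1) →L[ℝ] Form d (s + 1) →L[ℝ] ℝ, IsEllipticForm lam A →
    ∀ (x₀ : Space d) (ρ : ℝ), 0 < ρ →
    ∀ f : Space d → Form d (s + 1), IsSmoothSol A (Metric.ball x₀ ρ) f →
      ‖partials l f x₀‖ ^ 2 ≤
        C / ρ ^ (2 * l.length + d) * ∫ x in Metric.ball x₀ ρ, ‖f x‖ ^ 2 := by
  obtain ⟨C, hC, H⟩ := exists_partials_bound_unit d s hlam l
  refine ⟨C, hC, fun A hA x₀ ρ hρ f hf => ?_⟩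
  have h := H A hA _ (hf.comp_affine hρ)
  rw [partials_comp_affine hf.smooth] at h
  -- The change of variables produces `ρ^d`; the squared chain rule produces the remaining `ρ^(2
  -- |l|)`.
  have h1 : ∫ y in Metric.ball (0 : Space d) 1, ‖f (x₀ + ρ • y)‖ ^ 2 =
      (ρ ^ d)⁻¹ * ∫ x in Metric.ball x₀ ρ, ‖f x‖ ^ 2 := by
    rw [Measure.setIntegral_comp_smul_of_pos volume (fun y => ‖f (x₀ + y)‖ ^ 2) _ hρ,
      finrank_euclideanSpace_fin, smul_eq_mul, smul_ball hρ.ne', smul_zero, Real.norm_of_nonneg hρ.le,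
      mul_one]
    congr 1
    have := (measurePreserving_add_left (volume : Measure (Space d)) x₀).setIntegral_preimage_emb
      (measurableEmbedding_addLeft x₀) (fun y => ‖f y‖ ^ 2) (Metric.ball x₀ ρ)
    rw [← this]
    congr 2
    ext y
    simp
  beta_reduce at h
  rw [h1, smul_zero, add_zero, norm_smul, mul_pow, norm_pow, Real.norm_of_nonneg hρ.le] at h
  have h2 : 0 < (ρ ^ l.length) ^ 2 := by positivity
  rw [mul_comm, ← le_div_iff₀ h2] at h
  refine h.trans_eq ?_
  rw [pow_add, mul_comm 2, pow_mul]
  field_simp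

end

/-! ### Mollification and its convergence in `L²`. -/

section

variable {d : ℕ}

lemma tendsto_eLpNorm_translate {E : Type*} [NormedAddCommGroup E] {f : Space d → E} (hf : MemLp f 2 volume) :
    Filter.Tendsto (fun t : Space d => eLpNorm (fun x => f (x - t) - f x) 2 volume) (𝓝 0) (𝓝 0) := by
  let g : Space d → C(Space d, Space d) :=
    fun t => ⟨fun x => x - t, by fun_prop⟩
  have hg : Continuous g := by
    refine ContinuousMap.continuous_of_continuous_uncurry _ ?_
    change Continuous fun p : Space d × Space d => p.2 - p.1
    fun_prop
  have hgm : ∀ t, MeasurePreserving (g t) volume volume := fun t =>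
    measurePreserving_sub_right volume t
  have hc : Continuous fun t => Lp.compMeasurePreserving (g t) (hgm t) (hf.toLp f) :=
    continuous_const.compMeasurePreservingLp hg hgm (by simp)
  have h1 := ((hc.edist (continuous_const (y := hf.toLp f))).tendsto 0)
  have h2 : ∀ t, edist (Lp.compMeasurePreserving (g t) (hgm t) (hf.toLp f)) (hf.toLp f) =
      eLpNorm (fun x => f (x - t) - f x) 2 volume := by
    intro t
    rw [Lp.toLp_compMeasurePreserving, Lp.edist_toLp_toLp]
    rfl
  simp only [h2] at h1
  simpa using h1

variable {E : Type*} [NormedAddCommGroup E] [NormedSpace ℝ E]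

/-- Convolution of `f` with the normalized bump function `φ`. -/
def mollify (φ : ContDiffBump (0 : Space d)) (f : Space d → E) : Space d → E :=
  convolution (φ.normed volume) f (ContinuousLinearMap.lsmul ℝ ℝ) volume

lemma contDiff_mollify (φ : ContDiffBump (0 : Space d)) {f : Space d → E}
    (hf : LocallyIntegrable f volume) : ContDiff ℝ ∞ (mollify φ f) :=
  φ.hasCompactSupport_normed.contDiff_convolution_left _ φ.contDiff_normed hf

/-- The derivative falls on the kernel and `P` passes under the integral. A linear condition on the
gradient thus becomes an integral of `f` against derivatives of a test function. -/
lemma clm_fderiv_mollify [CompleteSpace E] (φ : ContDiffBump (0 : Space d)) {f : Space d → E}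
    (hf : LocallyIntegrable f volume) {W : Type*} [NormedAddCommGroup W] [NormedSpace ℝ W]
    [CompleteSpace W] (P : (Space d →L[ℝ] E) →L[ℝ] W) (x : Space d) :
    P (fderiv ℝ (mollify φ f) x) =
      ∫ y, P ((fderiv ℝ (φ.normed volume) (x - y)).smulRight (f y)) := by
  have hs : ContDiff ℝ 1 (φ.normed volume) := φ.contDiff_normed
  have h1 := φ.hasCompactSupport_normed.hasFDerivAt_convolution_left
    (ContinuousLinearMap.lsmul ℝ ℝ) (μ := volume) hs hf x
  have h2 : ConvolutionExistsAt (fderiv ℝ (φ.normed volume)) f x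
      (ContinuousLinearMap.precompL (Space d) (ContinuousLinearMap.lsmul ℝ ℝ)) volume :=
    (φ.hasCompactSupport_normed.fderiv (𝕜 := ℝ)).convolutionExists_left _
      (hs.continuous_fderiv (by simp)) hf x
  have h3 : ∀ y, ContinuousLinearMap.precompL (Space d)
      (ContinuousLinearMap.lsmul ℝ ℝ) (fderiv ℝ (φ.normed volume) (x - y)) (f y) =
      (fderiv ℝ (φ.normed volume) (x - y)).smulRight (f y) := by
    intro y
    ext1 w
    simp
  have h4 := h2.integrable_swap
  simp only [h3] at h4
  rw [mollify, h1.fderiv, convolution_eq_swap]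
  simp only [h3]
  exact (P.integral_comp_comm h4).symm

lemma mollify_sub_eq [CompleteSpace E] (φ : ContDiffBump (0 : Space d)) {f : Space d → E}
    (hf : LocallyIntegrable f volume) (x : Space d) :
    mollify φ f x - f x = ∫ t, φ.normed volume t • (f (x - t) - f x) := by
  have h2 : Integrable fun t => φ.normed volume t • f (x - t) :=
    φ.hasCompactSupport_normed.convolutionExists_left
      (ContinuousLinearMap.lsmul ℝ ℝ) φ.continuous_normed hf x
  have h3 : Integrable fun t => φ.normed volume t • f x :=
    (φ.integrable_normed).smul_const _
  simp only [smul_sub]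
  rw [integral_sub h2 h3, integral_smul_const, φ.integral_normed, one_smul]
  rfl

lemma isProbabilityMeasure_normed (φ : ContDiffBump (0 : Space d)) : IsProbabilityMeasure
    ((volume : Measure (Space d)).withDensity fun t => ENNReal.ofReal (φ.normed volume t)) := by
  constructor
  rw [withDensity_apply _ MeasurableSet.univ, Measure.restrict_univ,
    ← ofReal_integral_eq_lintegral_ofReal φ.integrable_normed
      (Filter.Eventually.of_forall fun x => φ.nonneg_normed x), φ.integral_normed]
  simp

/-- Jensen's inequality for the probability measure whose density is the normalized bump. -/
lemma enorm_integral_normed_smul_sq_le (φ : ContDiffBump (0 : Space d)) {g : Space d → E}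
    (hg : StronglyMeasurable g) :
    ‖∫ t, φ.normed volume t • g t‖ₑ ^ (2 : ℝ) ≤
      ∫⁻ t, ‖g t‖ₑ ^ (2 : ℝ) ∂(volume.withDensity fun t => ENNReal.ofReal (φ.normed volume t)) := by
  set ν := (volume : Measure (Space d)).withDensity fun t => ENNReal.ofReal (φ.normed volume t)
    with hν
  have hm : Measurable fun t => ENNReal.ofReal (φ.normed volume t) :=
    φ.continuous_normed.measurable.ennreal_ofReal
  have : IsProbabilityMeasure ν := isProbabilityMeasure_normed φ
  have h1 : ∫ t, φ.normed volume t • g t = ∫ t, g t ∂ν := by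
    rw [hν, integral_withDensity_eq_integral_toReal_smul hm (by simp)]
    simp [ENNReal.toReal_ofReal (φ.nonneg_normed _)]
  rw [h1]
  have h2 := eLpNorm'_le_eLpNorm'_of_exponent_le (p := 1) (q := 2) (by norm_num) (by norm_num) ν
    hg.aestronglyMeasurable
  simp only [eLpNorm'_eq_lintegral_enorm, ENNReal.rpow_one, div_one] at h2
  calc _ ≤ ((∫⁻ t, ‖g t‖ₑ ^ (2 : ℝ) ∂ν) ^ (1 / (2 : ℝ))) ^ (2 : ℝ) := by
        gcongr
        exact (enorm_integral_le_lintegral_enorm _).trans h2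
    _ = _ := by rw [← ENNReal.rpow_mul]; norm_num

/-- By Jensen and Tonelli, the squared error is at most an average over small `t` of the squared
`L²` distance between `f` and its translate by `t`. -/
lemma exists_eLpNorm_mollify_sub_le [CompleteSpace E] {f : Space d → E}
    (hfm : StronglyMeasurable f) (hf : MemLp f 2 volume) {ε : ℝ≥0∞} (hε : 0 < ε) :
    ∃ δ > 0, ∀ φ : ContDiffBump (0 : Space d), φ.rOut < δ →
      eLpNorm (fun x => mollify φ f x - f x) 2 volume ≤ ε := by
  have h0 := (ENNReal.tendsto_nhds_zero.mp (tendsto_eLpNorm_translate hf)) ε hε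
  obtain ⟨δ, hδ, hb⟩ := Metric.eventually_nhds_iff_ball.mp h0
  refine ⟨δ, hδ, fun φ hφ => ?_⟩
  have hloc : LocallyIntegrable f volume := hf.locallyIntegrable (by norm_num)
  have hL : ∀ g : Space d → E,
      eLpNorm g 2 volume = (∫⁻ x, ‖g x‖ₑ ^ (2 : ℝ)) ^ (1 / (2 : ℝ)) := fun g => by
    rw [eLpNorm_eq_lintegral_rpow_enorm_toReal (by simp) (by simp)]
    simp
  rw [hL]
  set ν := (volume : Measure (Space d)).withDensity fun t => ENNReal.ofReal (φ.normed volume t)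
    with hν
  have hm : Measurable fun t => ENNReal.ofReal (φ.normed volume t) :=
    φ.continuous_normed.measurable.ennreal_ofReal
  have hsm : ∀ x : Space d, StronglyMeasurable fun t => f (x - t) - f x := fun x =>
    (hfm.comp_measurable (measurable_const.sub measurable_id)).sub stronglyMeasurable_const
  have h1 : ∫⁻ x, ‖mollify φ f x - f x‖ₑ ^ (2 : ℝ) ≤
      ∫⁻ x, ∫⁻ t, ‖f (x - t) - f x‖ₑ ^ (2 : ℝ) ∂ν := by
    refine lintegral_mono fun x => ?_
    rw [mollify_sub_eq φ hloc]
    exact enorm_integral_normed_smul_sq_le φ (hsm x)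
  have hmeas : AEMeasurable (Function.uncurry fun x t : Space d => ‖f (x - t) - f x‖ₑ ^ (2 : ℝ))
      (volume.prod ν) := by
    have h : StronglyMeasurable fun p : Space d × Space d => f (p.1 - p.2) - f p.1 :=
      (hfm.comp_measurable (measurable_fst.sub measurable_snd)).sub
        (hfm.comp_measurable measurable_fst)
    exact (h.enorm.pow_const (2 : ℝ)).aemeasurable
  have : IsProbabilityMeasure ν := isProbabilityMeasure_normed φ
  rw [lintegral_lintegral_swap hmeas] at h1
  have h2 : ∫⁻ t, (∫⁻ x, ‖f (x - t) - f x‖ₑ ^ (2 : ℝ)) ∂ν ≤ ε ^ (2 : ℝ) := by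
    calc _ ≤ ∫⁻ _, ε ^ (2 : ℝ) ∂ν := by
          refine lintegral_mono_ae ?_
          -- The averaging measure only charges translations shorter than `φ.rOut`.
          rw [hν, ae_withDensity_iff hm]
          refine Filter.Eventually.of_forall fun t ht => ?_
          have ht' : t ∈ Metric.ball (0 : Space d) φ.rOut := by
            rw [← φ.support_normed_eq (μ := volume), Function.mem_support]
            exact fun h => ht (by simp [h])
          have hbt := hb t (Metric.ball_subset_ball hφ.le ht')
          rw [hL] at hbt
          calc _ = ((∫⁻ x, ‖f (x - t) - f x‖ₑ ^ (2 : ℝ)) ^ (1 / (2 : ℝ))) ^ (2 : ℝ) := by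
                rw [← ENNReal.rpow_mul]; norm_num
            _ ≤ _ := by gcongr
      _ = _ := by simp
  calc _ ≤ (ε ^ (2 : ℝ)) ^ (1 / (2 : ℝ)) := by
        gcongr
        exact h1.trans h2
    _ = ε := by rw [← ENNReal.rpow_mul]; norm_num

end

/-! ### Mollified weak solutions solve the system classically; balls around points of `U_R`. -/

section

variable {d r q s n : ℕ}

lemma dxWedge_smul (i : Fin d) (c : ℝ) (b : Form d q) : dxWedge i (c • b) = c • dxWedge i b := by
  ext v
  simp only [dxWedge_apply, ContinuousAlternatingMap.smul_apply, smul_eq_mul, Finset.mul_sum]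
  exact Finset.sum_congr rfl fun _ _ => by ring

/-- The divergence-type functional `L ↦ ∑ B(L e_i, dx_i ∧ b)`. -/
def pairDiv (B : Form d r →L[ℝ] Form d (n + 1) →L[ℝ] ℝ) (b : Form d n) :
    (Space d →L[ℝ] Form d r) →L[ℝ] ℝ :=
  ∑ i, (B.flip (dxWedge i b)).comp (ContinuousLinearMap.apply ℝ (Form d r) (basisVec d i))

lemma pairDiv_apply (B : Form d r →L[ℝ] Form d (n + 1) →L[ℝ] ℝ) (b : Form d n)
    (L : Space d →L[ℝ] Form d r) :
    pairDiv B b L = ∑ i, B (L (basisVec d i)) (dxWedge i b) := by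
  simp [pairDiv]

/-- With `w` the differential of a scalar `ψ`, the form `w ∧ b` is `d(ψ b)`. This turns the
differentiated mollification into the tested weak equation. -/
lemma pairDiv_smulRight (B : Form d r →L[ℝ] Form d (n + 1) →L[ℝ] ℝ) (b : Form d n)
    (w : Space d →L[ℝ] ℝ) (p : Form d r) :
    pairDiv B b (w.smulRight p) = B p (alternatizeUncurryFin (w.smulRight b)) := by
  simp [pairDiv_apply, alternatize_eq_sum, dxWedge_smul]

/-- A mollification inherits a weak equation `∫ B(f, dv) = 0` as a pointwise equation. -/
lemma pairDiv_fderiv_mollify (B : Form d r →L[ℝ] Form d (n + 1) →L[ℝ] ℝ) {U : Set (Space d)}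
    {f : Space d → Form d r} (hf : LocallyIntegrable f volume)
    (hB : ∀ v : Space d → Form d n, IsTestForm U v → ∫ x in U, B (f x) (extDeriv v x) = 0)
    (φ : ContDiffBump (0 : Space d)) {x : Space d} (hx : Metric.closedBall x φ.rOut ⊆ U)
    (b : Form d n) :
    ∑ i, B (fderiv ℝ (mollify φ f) x (basisVec d i)) (dxWedge i b) = 0 := by
  set ψ : Space d → ℝ := φ.normed volume with hψ
  have hψs : ContDiff ℝ ∞ ψ := φ.contDiff_normed
  -- The test form is the kernel reflected about `x` times a constant form; the reflection accounts
  -- for the minus sign in `hd`.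
  set v : Space d → Form d n := fun y => ψ (x - y) • b with hv
  have hd : ∀ y, extDeriv v y = - alternatizeUncurryFin ((fderiv ℝ ψ (x - y)).smulRight b) := by
    intro y
    have h1 : HasFDerivAt (fun y : Space d => x - y) (-ContinuousLinearMap.id ℝ (Space d)) y := by
      simpa using (hasFDerivAt_id y).const_sub x
    have h2 := ((hψs.differentiable (by simp)).differentiableAt
      (x := x - y)).hasFDerivAt.comp y h1
    have h3 := (h2.smul_const b).fderiv
    rw [extDeriv]
    change alternatizeUncurryFin (fderiv ℝ (fun y => (ψ ∘ fun y => x - y) y • b) y) = _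
    rw [h3, ← alternatizeUncurryFinCLM_apply, ← alternatizeUncurryFinCLM_apply, ← _root_.map_neg]
    congr 1
    ext1 w
    simp
  have hvz : ∀ y ∉ Metric.closedBall x φ.rOut, v y = 0 := by
    intro y hy
    have : ψ (x - y) = 0 := by
      have h : x - y ∉ Function.support ψ := by
        rw [hψ, φ.support_normed_eq, mem_ball_zero_iff, ← dist_eq_norm, dist_comm]
        exact fun h => hy h.le
      simpa using h
    simp [hv, this]
  have hvt : tsupport v ⊆ Metric.closedBall x φ.rOut := by
    refine closure_minimal (fun y hy => ?_) Metric.isClosed_closedBall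
    by_contra h
    exact hy (hvz y h)
  have htest : IsTestForm U v := by
    refine ⟨?_, HasCompactSupport.intro (isCompact_closedBall x φ.rOut) hvz, hvt.trans hx⟩
    exact (hψs.comp (contDiff_const.sub contDiff_id)).smul contDiff_const
  have h0 := hB v htest
  rw [setIntegral_eq_integral_of_forall_compl_eq_zero] at h0
  · rw [← pairDiv_apply, clm_fderiv_mollify φ hf]
    simp only [pairDiv_smulRight]
    simp only [hd, _root_.map_neg, integral_neg, neg_eq_zero] at h0
    exact h0
  · intro y hy
    have : fderiv ℝ v y = 0 := image_eq_zero_of_notMem_tsupport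
      fun h => hy (hx (hvt (tsupport_fderiv_subset ℝ h)))
    rw [extDeriv, this, ← alternatizeUncurryFinCLM_apply, _root_.map_zero, _root_.map_zero]

/-- Needed to insert `dv` into the definition of the weak derivative: since `d(dv) = 0`, what
remains is `∫ du ∧ dv = 0`, the weak form of `d(du) = 0`. -/
lemma IsTestForm.extDeriv {U : Set (Space d)} {v : Space d → Form d n} (hv : IsTestForm U v) :
    IsTestForm U (extDeriv v) := by
  have hsub : tsupport (_root_.extDeriv v) ⊆ tsupport v := by
    refine closure_minimal (fun y hy => ?_) (isClosed_tsupport _)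
    by_contra h
    have h0 : fderiv ℝ v y = 0 := image_eq_zero_of_notMem_tsupport
      fun h' => h (tsupport_fderiv_subset ℝ h')
    refine hy ?_
    rw [_root_.extDeriv, h0, ← alternatizeUncurryFinCLM_apply, _root_.map_zero]
  exact ⟨(alternatizeUncurryFinCLM ℝ (Space d) ℝ).contDiff.comp
    (hv.smooth.fderiv_right (by simp)),
    hv.compact.of_isClosed_subset (isClosed_tsupport _) hsub, hsub.trans hv.support⟩

lemma topWedge_zero (h : r + q = d) (p : Form d r) : topWedge h p 0 = 0 :=
  _root_.map_zero (topWedgeL h p)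

/-- Mollifications of the exterior derivative of a weak solution solve the system classically. -/
lemma IsSolution.isSmoothSol_mollify {h : (s + 1) + q = d}
    {a : Form d (s + 1) →ₗ[ℝ] Form d q} {U : Set (Space d)}
    {u : Space d → Form d s} {du : Space d → Form d (s + 1)} (hu : IsSolution h a U u du)
    {f : Space d → Form d (s + 1)} (hf : LocallyIntegrable f volume)
    (hfdu : f =ᵐ[volume.restrict U] du) (φ : ContDiffBump (0 : Space d)) {V : Set (Space d)}
    (hV : ∀ x ∈ V, Metric.closedBall x φ.rOut ⊆ U) :
    IsSmoothSol (energyForm h a) V (mollify φ f) := by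
  refine ⟨contDiff_mollify φ hf, fun x hx => ?_, fun x hx b => ?_⟩
  · rcases q with _ | n
    -- For `q = 0` the form `d(du)` has degree `d + 1`, and there is no injective index tuple of
    -- that length.
    · refine form_eq_zero_of_basis _ fun m hm => ?_
      have := Fintype.card_le_of_injective m hm
      simp only [Fintype.card_fin] at this
      omega
    · refine alternatize_eq_zero h (by omega) _ fun b => ?_
      refine pairDiv_fderiv_mollify (topWedgeL h) hf (fun v hv => ?_) φ (hV x hx) b
      have h1 := hu.hasDeriv _ hv.extDeriv
      have h2 : _root_.extDeriv (_root_.extDeriv v) = 0 := extDeriv_extDeriv hv.smooth (by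
        simp only [minSmoothness_of_isRCLikeNormedField]
        exact WithTop.coe_le_coe.mpr le_top)
      simp only [h2, Pi.zero_apply, topWedge_zero, zero_add, integral_const_mul] at h1
      have h3 := (mul_eq_zero.mp h1).resolve_left (pow_ne_zero _ (by norm_num))
      rw [← h3]
      refine integral_congr_ae ?_
      filter_upwards [hfdu] with y hy
      rw [hy]; rfl
  · refine pairDiv_fderiv_mollify (energyForm h a) hf (fun v hv => ?_) φ (hV x hx) b
    rw [← hu.weakEq v hv]
    refine integral_congr_ae ?_
    filter_upwards [hfdu] with y hy
    rw [hy]; rfl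

lemma isOpen_innerSet {U : Set (Space d)} (hU : IsOpen U) (R : ℝ) : IsOpen (innerSet U R) :=
  hU.inter (isOpen_lt continuous_const (Metric.continuous_infDist_pt _))

/-- The ball is connected and contains no frontier point, so it cannot meet both `U` and its
complement. -/
lemma ball_subset_of_mem_innerSet {U : Set (Space d)} (hU : IsOpen U) {R : ℝ} {x : Space d}
    (hx : x ∈ innerSet U R) : Metric.ball x R ⊆ U := by
  intro y hy
  by_contra hyU
  have hR : 0 < R := Metric.pos_of_mem_ball hy
  have hc : IsPreconnected (Metric.ball x R) := (convex_ball x R).isPreconnected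
  have hfr : ∀ z ∈ Metric.ball x R, z ∉ frontier U := by
    intro z hz hzf
    have h1 := Metric.infDist_le_dist_of_mem (x := x) hzf
    rw [Metric.mem_ball, dist_comm] at hz
    exact absurd hx.2 (not_lt.mpr (h1.trans hz.le))
  have hcl : ∀ z ∈ Metric.ball x R, z ∉ U → z ∈ (closure U)ᶜ := fun z hz hzU hzc =>
    hfr z hz (by rw [hU.frontier_eq]; exact ⟨hzc, hzU⟩)
  obtain ⟨z, -, hz1, hz2⟩ := hc U (closure U)ᶜ hU isClosed_closure.isOpen_compl
    (fun z hz => (em (z ∈ U)).imp id (hcl z hz))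
    ⟨x, Metric.mem_ball_self hR, hx.1⟩ ⟨y, hy, hcl y hy hyU⟩
  exact hz2 (subset_closure hz1)

end

/-! ### From smooth approximations to bounded weak derivatives. -/

section

variable {d r q s k : ℕ}

lemma setIntegral_sq_le_eLpNorm_sq {F : Type*} [NormedAddCommGroup F] {g : Space d → F} (hg : MemLp g 2 volume) (S : Set (Space d)) :
    ∫ x in S, ‖g x‖ ^ 2 ≤ (eLpNorm g 2 volume).toReal ^ 2 := by
  have hi : Integrable fun x => ‖g x‖ ^ 2 := hg.integrable_norm_pow (by norm_num)
  refine (setIntegral_le_integral hi (Filter.Eventually.of_forall fun x => by positivity)).trans ?_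
  rw [hg.eLpNorm_eq_integral_rpow_norm (by simp) (by simp), ENNReal.toReal_ofReal (by positivity)]
  simp only [ENNReal.toReal_ofNat, Real.rpow_ofNat]
  rw [← Real.rpow_natCast, ← Real.rpow_mul (integral_nonneg fun _ => by positivity)]
  norm_num

/-- A strongly measurable representative is chosen so that `f (x - t) - f x` is jointly measurable
in the Tonelli argument for mollifications. -/
lemma exists_zero_extension {F : Type*} [NormedAddCommGroup F]
    {U : Set (Space d)} (hU : MeasurableSet U) {w : Space d → F}
    (hw : MemLp w 2 (volume.restrict U)) :
    ∃ f : Space d → F, StronglyMeasurable f ∧ MemLp f 2 volume ∧ f =ᵐ[volume.restrict U] w ∧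
      eLpNorm f 2 volume = eLpNorm w 2 (volume.restrict U) := by
  have hind : MemLp (U.indicator w) 2 volume := (memLp_indicator_iff_restrict hU).mpr hw
  obtain ⟨f, hfm, hfae⟩ := hind.1
  refine ⟨f, hfm, hind.ae_eq hfae, ?_, ?_⟩
  · filter_upwards [ae_restrict_of_ae hfae, ae_restrict_mem hU] with x hx hxU
    rw [← hx, Set.indicator_of_mem hxU]
  · rw [← eLpNorm_congr_ae hfae, eLpNorm_indicator_eq_eLpNorm_restrict hU]

lemma memLp_of_eLpNorm_sub_le {F : Type*} [NormedAddCommGroup F]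
    {f g : Space d → F} (hf : MemLp f 2 volume) (hg : AEStronglyMeasurable g volume)
    {ε : ℝ} (h : eLpNorm (fun x => g x - f x) 2 volume ≤ ENNReal.ofReal ε) :
    MemLp g 2 volume := by
  have h1 : MemLp (fun x => g x - f x) 2 volume := ⟨hg.sub hf.1, h.trans_lt ENNReal.ofReal_lt_top⟩
  have h2 : g = (fun x => g x - f x) + f := by ext1 x; simp
  exact h2 ▸ h1.add hf

lemma toReal_eLpNorm_le_add {F : Type*} [NormedAddCommGroup F]
    {f g : Space d → F} (hf : MemLp f 2 volume)
    (hg : AEStronglyMeasurable g volume) {ε : ℝ} (hε : 0 ≤ ε)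
    (h : eLpNorm (fun x => g x - f x) 2 volume ≤ ENNReal.ofReal ε) :
    (eLpNorm g 2 volume).toReal ≤ (eLpNorm f 2 volume).toReal + ε := by
  have h1 : eLpNorm g 2 volume ≤ eLpNorm f 2 volume + ENNReal.ofReal ε := by
    have h2 : g = f + fun x => g x - f x := by ext1 x; simp
    calc eLpNorm g 2 volume = eLpNorm (f + fun x => g x - f x) 2 volume := by rw [← h2]
      _ ≤ _ := (eLpNorm_add_le hf.1 (hg.sub hf.1) (by norm_num)).trans (by gcongr; exact h)
  refine (ENNReal.toReal_mono (by simp [hf.2.ne]) h1).trans_eq ?_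
  rw [ENNReal.toReal_add hf.2.ne (by simp), ENNReal.toReal_ofReal hε]

lemma toReal_eLpNorm_sub_le_add {F : Type*} [NormedAddCommGroup F]
    {f g g' : Space d → F} (hf : MemLp f 2 volume)
    (hg : AEStronglyMeasurable g volume) (hg' : AEStronglyMeasurable g' volume)
    {ε ε' : ℝ} (hε : 0 ≤ ε) (hε' : 0 ≤ ε')
    (h : eLpNorm (fun x => g x - f x) 2 volume ≤ ENNReal.ofReal ε)
    (h' : eLpNorm (fun x => g' x - f x) 2 volume ≤ ENNReal.ofReal ε') :
    (eLpNorm (fun x => g x - g' x) 2 volume).toReal ≤ ε + ε' := by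
  have h1 : eLpNorm (fun x => g x - g' x) 2 volume ≤ ENNReal.ofReal ε + ENNReal.ofReal ε' := by
    have h2 : (fun x => g x - g' x) = (fun x => g x - f x) - fun x => g' x - f x := by
      ext1 x; simp
    rw [h2]
    exact (eLpNorm_sub_le (hg.sub hf.1) (hg'.sub hf.1) (by norm_num)).trans (add_le_add h h')
  refine (ENNReal.toReal_mono (by simp) h1).trans_eq ?_
  rw [ENNReal.toReal_add (by simp) (by simp), ENNReal.toReal_ofReal hε, ENNReal.toReal_ofReal hε']

section

variable {F : Type*} [NormedAddCommGroup F] [NormedSpace ℝ F]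

/-- `partials` applies the head of the list first, while the iterated derivative is peeled off from
the last direction, hence the reversal. It matches the reversal caused by repeated integration by
parts in `integral_mul_partials`. -/
lemma iteratedFDeriv_eq_partials {φ : Space d → F} (hφ : ContDiff ℝ ∞ φ) (i : Fin k → Fin d)
    (x : Space d) :
    iteratedFDeriv ℝ k φ x (fun j => basisVec d (i j)) = partials (List.ofFn i).reverse φ x := by
  induction k generalizing φ with
  | zero => simp [partials]
  | succ k ih =>
    rw [iteratedFDeriv_succ_apply_right, List.ofFn_succ', List.concat_eq_append,
      List.reverse_append, List.reverse_singleton, List.singleton_append, partials,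
      ← ih (ContDiff.dirDeriv hφ _)]
    have h1 : ContDiff ℝ ∞ (fderiv ℝ φ) := hφ.fderiv_right (by simp)
    exact (iteratedFDeriv_clm_apply_const_apply h1 (by exact_mod_cast le_top)).symm

lemma integral_mul_partials (T : F →L[ℝ] ℝ) {g : Space d → F} (hg : ContDiff ℝ ∞ g)
    {ψ : Space d → ℝ} (hψ : ContDiff ℝ ∞ ψ) (hψc : HasCompactSupport ψ) (l : List (Fin d)) :
    ∫ x, T (g x) * partials l.reverse ψ x = (-1) ^ l.length * ∫ x, T (partials l g x) * ψ x := by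
  induction l generalizing g with
  | nil => simp [partials]
  | cons i l ih =>
    have hl := ContDiff.partials hψ l.reverse
    have hlc := HasCompactSupport.partials hψc l.reverse
    have hd := ContDiff.dirDeriv hl (basisVec d i)
    have hg' := ContDiff.dirDeriv hg (basisVec d i)
    have hint : ∀ {G : Space d → F} {θ : Space d → ℝ}, Continuous G → Continuous θ →
        HasCompactSupport θ → Integrable fun x =>
          ((ContinuousLinearMap.mul ℝ ℝ).comp T) (G x) (θ x) := fun hG hθ hθc =>
      ((T.continuous.comp hG).mul hθ).integrable_of_hasCompactSupport hθc.mul_left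
    have h1 := integral_bilinear_fderiv_right_eq_neg_left_of_integrable
      (B := (ContinuousLinearMap.mul ℝ ℝ).comp T) (f := g) (g := partials l.reverse ψ)
      (v := basisVec d i) (μ := volume)
      (hint hg'.continuous hl.continuous hlc)
      (hint hg.continuous hd.continuous
        (hlc.of_isClosed_subset (isClosed_tsupport _) (tsupport_dirDeriv_subset _ _)))
      (hint hg.continuous hl.continuous hlc)
      (fun x _ => (hg.differentiable (by simp)).differentiableAt)
      (fun x _ => (hl.differentiable (by simp)).differentiableAt)
    rw [List.reverse_cons, partials_append]
    change ∫ x, T (g x) * fderiv ℝ (partials l.reverse ψ) x (basisVec d i) = _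
    refine h1.trans ?_
    have h2 := ih hg'
    change -(∫ x, T (dirDeriv (basisVec d i) g x) * partials l.reverse ψ x) = _
    rw [h2, List.length_cons, pow_succ]
    simp [partials]

lemma tendsto_integral_mul_of_tendsto_eLpNorm {S : Set (Space d)} {f : Space d → F}
    {g : ℕ → Space d → F} (hf : MemLp f 2 volume) (hg : ∀ n, MemLp (g n) 2 volume)
    (h : Filter.Tendsto (fun n => eLpNorm (fun x => g n x - f x) 2 volume) Filter.atTop (𝓝 0))
    (T : F →L[ℝ] ℝ) {ψ : Space d → ℝ} (hψ : MemLp ψ 2 volume) :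
    Filter.Tendsto (fun n => ∫ x in S, T (g n x) * ψ x) Filter.atTop
      (𝓝 (∫ x in S, T (f x) * ψ x)) := by
  have hint : ∀ {G : Space d → F}, MemLp G 2 volume → Integrable fun x => T (G x) * ψ x :=
    fun hG => (T.comp_memLp' hG).integrable_mul hψ
  refine tendsto_integral_of_L1' _ (hint hf).integrableOn.1
    (Filter.Eventually.of_forall fun n => (hint (hg n)).integrableOn) ?_
  have hb : ∀ n, eLpNorm ((fun x => T (g n x) * ψ x) - fun x => T (f x) * ψ x) 1
      (volume.restrict S) ≤ eLpNorm ψ 2 volume *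
        (ENNReal.ofReal ‖T‖ * eLpNorm (fun x => g n x - f x) 2 volume) := by
    intro n
    have hm : MemLp (fun x => T (g n x - f x)) 2 volume := T.comp_memLp' ((hg n).sub hf)
    have h1 : ((fun x => T (g n x) * ψ x) - fun x => T (f x) * ψ x) =
        ψ • fun x => T (g n x - f x) := by
      ext x
      simp only [Pi.sub_apply, _root_.map_sub, Pi.smul_apply', smul_eq_mul]
      ring
    rw [h1]
    refine (eLpNorm_mono_measure _ Measure.restrict_le_self).trans ?_
    refine (eLpNorm_smul_le_mul_eLpNorm (p := 2) (q := 2) (r := 1) hm.1 hψ.1).trans ?_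
    gcongr
    exact eLpNorm_le_mul_eLpNorm_of_ae_le_mul
      (Filter.Eventually.of_forall fun x => T.le_opNorm _) _
  refine tendsto_of_tendsto_of_tendsto_of_le_of_le tendsto_const_nhds ?_ (fun _ => zero_le) hb
  have h2 : Filter.Tendsto (fun n => eLpNorm ψ 2 volume *
      (ENNReal.ofReal ‖T‖ * eLpNorm (fun x => g n x - f x) 2 volume)) Filter.atTop
      (𝓝 (eLpNorm ψ 2 volume * (ENNReal.ofReal ‖T‖ * 0))) :=
    ENNReal.Tendsto.const_mul (ENNReal.Tendsto.const_mul h (Or.inr (by simp))) (Or.inr hψ.2.ne)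
  simpa using h2

/-- An `L²` function is approximated by its mollifications. -/
lemma exists_mollify_approx [CompleteSpace F] {f : Space d → F} (hfm : StronglyMeasurable f)
    (hf : MemLp f 2 volume) {ρ : ℝ} (hρ : 0 < ρ) :
    ∃ φ : ℕ → ContDiffBump (0 : Space d), (∀ n, (φ n).rOut < ρ) ∧ ∀ n,
      eLpNorm (fun x => mollify (φ n) f x - f x) 2 volume ≤ ENNReal.ofReal (1 / ((n : ℝ) + 1)) := by
  have hex : ∀ n : ℕ, ∃ φ : ContDiffBump (0 : Space d), φ.rOut < ρ ∧
      eLpNorm (fun x => mollify φ f x - f x) 2 volume ≤ ENNReal.ofReal (1 / ((n : ℝ) + 1)) := by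
    intro n
    obtain ⟨δ, hδ, hb⟩ := exists_eLpNorm_mollify_sub_le hfm hf
      (ENNReal.ofReal_pos.mpr (show (0 : ℝ) < 1 / ((n : ℝ) + 1) by positivity))
    have hm : 0 < min δ ρ := lt_min hδ hρ
    have hlt : min δ ρ / 2 < min δ ρ := by linarith
    exact ⟨⟨min δ ρ / 3, min δ ρ / 2, by positivity, by linarith⟩,
      hlt.trans_le (min_le_right _ _), hb _ (hlt.trans_le (min_le_left _ _))⟩
  choose φ hφR hφ using hex
  exact ⟨φ, hφR, hφ⟩

/-- If smooth functions converge to `f` in `L²` and their derivatives converge uniformly on `V`,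
then `f` has a bounded weak derivative on `V`. -/
lemma exists_weak_limit [CompleteSpace F] {V : Set (Space d)} (hVm : MeasurableSet V)
    {f : Space d → F} {g : ℕ → Space d → F} (hf : MemLp f 2 volume)
    (hgs : ∀ n, ContDiff ℝ ∞ (g n)) (hg2 : ∀ n, MemLp (g n) 2 volume) {α : ℕ → ℝ}
    (hαt : Filter.Tendsto α Filter.atTop (𝓝 0)) (hαa : Antitone α) (hα1 : ∀ n, α n ≤ 1)
    (hφ : ∀ n, eLpNorm (fun x => g n x - f x) 2 volume ≤ ENNReal.ofReal (α n))
    {b N : ℝ} (hb0 : 0 ≤ b) (l : List (Fin d))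
    (hB1 : ∀ n m, ∀ x ∈ V, ‖partials l (g n) x - partials l (g m) x‖ ≤ b * (α n + α m))
    (hB2 : ∀ n, ∀ x ∈ V, ‖partials l (g n) x‖ ≤ b * (N + α n)) :
    ∃ G : Space d → F, AEStronglyMeasurable G (volume.restrict V) ∧ (∀ x ∈ V, ‖G x‖ ≤ b * N) ∧
      ∀ (T : F →L[ℝ] ℝ) (ψ : Space d → ℝ), ContDiff ℝ ∞ ψ → HasCompactSupport ψ →
        tsupport ψ ⊆ V → ∫ x in V, T (f x) * partials l.reverse ψ x =
          (-1) ^ l.length * ∫ x in V, T (G x) * ψ x := by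
  have hlim : ∀ x, ∃ y, x ∈ V →
      Filter.Tendsto (fun n => partials l (g n) x) Filter.atTop (𝓝 y) := by
    intro x
    by_cases hx : x ∈ V
    · have hcs : CauchySeq fun n => partials l (g n) x := by
        refine cauchySeq_of_le_tendsto_0 (fun n => b * (α n + α n)) (fun n m M hn hm => ?_) ?_
        · rw [dist_eq_norm]
          refine (hB1 n m x hx).trans ?_
          gcongr <;> exact hαa ‹_›
        · simpa using (hαt.add hαt).const_mul b
      obtain ⟨y, hy⟩ := cauchySeq_tendsto_of_complete hcs
      exact ⟨y, fun _ => hy⟩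
    · exact ⟨0, fun h => absurd h hx⟩
  choose G hG using hlim
  have hGb : ∀ x ∈ V, ‖G x‖ ≤ b * N := by
    intro x hx
    refine le_of_tendsto_of_tendsto' (hG x hx).norm ?_ fun n => hB2 n x hx
    simpa using (hαt.const_add N).const_mul b
  have hGm : AEStronglyMeasurable G (volume.restrict V) := by
    refine aestronglyMeasurable_of_tendsto_ae Filter.atTop
      (fun n => (ContDiff.partials (hgs n) l).continuous.aestronglyMeasurable) ?_
    filter_upwards [ae_restrict_mem hVm] with x hx using hG x hx
  refine ⟨G, hGm, hGb, fun T ψ hψ hψc hψV => ?_⟩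
  have hψl := ContDiff.partials hψ l.reverse
  have hψlc := HasCompactSupport.partials hψc l.reverse
  have hψlt := (tsupport_partials_subset ψ l.reverse).trans hψV
  have hn : ∀ n, ∫ x in V, T (g n x) * partials l.reverse ψ x =
      (-1) ^ l.length * ∫ x in V, T (partials l (g n) x) * ψ x := by
    intro n
    have h1 := integral_mul_partials T (hgs n) hψ hψc l
    rw [setIntegral_eq_integral_of_forall_compl_eq_zero, h1,
      setIntegral_eq_integral_of_forall_compl_eq_zero]
    · intro x hx
      rw [image_eq_zero_of_notMem_tsupport fun hx' => hx (hψV hx'), mul_zero]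
    · intro x hx
      rw [image_eq_zero_of_notMem_tsupport fun hx' => hx (hψlt hx'), mul_zero]
  have hgt : Filter.Tendsto (fun n => eLpNorm (fun x => g n x - f x) 2 volume)
      Filter.atTop (𝓝 0) := by
    refine tendsto_of_tendsto_of_tendsto_of_le_of_le tendsto_const_nhds ?_
      (fun _ => zero_le) hφ
    simpa using ENNReal.tendsto_ofReal hαt
  -- The side with `f` converges by `L²` convergence, the side with derivatives by dominated
  -- convergence. Uniqueness of limits identifies the weak derivative.
  have hL := tendsto_integral_mul_of_tendsto_eLpNorm (S := V) hf hg2 hgt T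
    (hψl.continuous.memLp_of_hasCompactSupport hψlc)
  have hR' : Filter.Tendsto
      (fun n => ∫ x in V, T (partials l (g n) x) * ψ x) Filter.atTop
      (𝓝 (∫ x in V, T (G x) * ψ x)) := by
    refine tendsto_integral_of_dominated_convergence (fun x => ‖T‖ * (b * (N + 1)) * ‖ψ x‖)
      (fun n => ?_) ?_ (fun n => ?_) ?_
    · exact ((T.continuous.comp
        (ContDiff.partials (hgs n) _).continuous).mul hψ.continuous).aestronglyMeasurable
    · exact ((hψ.continuous.integrable_of_hasCompactSupport hψc).norm.const_mul _).integrableOn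
    · filter_upwards [ae_restrict_mem hVm] with x hx
      rw [norm_mul]
      gcongr
      refine (T.le_opNorm _).trans ?_
      gcongr
      refine (hB2 n x hx).trans ?_
      gcongr
      exact hα1 n
    · filter_upwards [ae_restrict_mem hVm] with x hx
      exact ((T.continuous.tendsto _).comp (hG x hx)).mul_const _
  simp only [hn] at hL
  exact tendsto_nhds_unique hL (hR'.const_mul _)

end

lemma aestronglyMeasurable_of_coeff {μ : Measure (Space d)} {w : Space d → Form d r}
    (hw : ∀ I, AEStronglyMeasurable (fun x => coeff (w x) I) μ) : AEStronglyMeasurable w μ := by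
  obtain ⟨T, hT⟩ := (coeffs d r).exists_leftInverse_of_injective ker_coeffs
  have h1 : AEStronglyMeasurable (fun x => coeffs d r (w x)) μ :=
    (aemeasurable_pi_iff.mpr fun I => (hw I).aemeasurable).aestronglyMeasurable
  have h2 := (LinearMap.continuous_of_finiteDimensional T).comp_aestronglyMeasurable h1
  refine h2.congr (Filter.Eventually.of_forall fun x => ?_)
  exact LinearMap.congr_fun hT (w x)

/-- The `L²` norm is controlled by the sum of the `L²` norms of the coefficients. -/
lemma exists_eLpNorm_le_lpNormForm (d r : ℕ) : ∃ K : ℝ, 0 < K ∧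
    ∀ (V : Set (Space d)) (w : Space d → Form d r), MemLpForm 2 V w →
      eLpNorm w 2 (volume.restrict V) ≤ ENNReal.ofReal K * lpNormForm 2 V w := by
  obtain ⟨K, hK, hKn⟩ := norm_le_coeff d r
  refine ⟨K, hK, fun V w hw => ?_⟩
  have h1 : eLpNorm w 2 (volume.restrict V) ≤ ENNReal.ofReal K *
      eLpNorm (∑ I : Fin r ↪o Fin d, fun x => ‖coeff (w x) I‖) 2 (volume.restrict V) := by
    refine eLpNorm_le_mul_eLpNorm_of_ae_le_mul (Filter.Eventually.of_forall fun x => ?_) _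
    rw [Finset.sum_apply, Real.norm_of_nonneg (Finset.sum_nonneg fun _ _ => norm_nonneg _)]
    exact (hKn (w x)).1
  refine h1.trans ?_
  gcongr
  refine (eLpNorm_sum_le (fun I _ => (hw I).1.norm) (by norm_num)).trans ?_
  simp only [eLpNorm_norm]
  rfl

/-- Each iterated weak derivative of `du` exists and is bounded on the inner set. -/
lemma exists_weakPartial (d s : ℕ) {lam : ℝ} (hlam : 0 < lam) (i : Fin k → Fin d) :
    ∃ C : ℝ, 0 < C ∧ ∀ (q : ℕ) (h : (s + 1) + q = d) (a : Form d (s + 1) →ₗ[ℝ] Form d q),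
      IsEllipticCoeff h lam a → ∀ U : Set (Space d), IsOpen U → ∀ R : ℝ, 0 < R →
      ∀ (u : Space d → Form d s) (du : Space d → Form d (s + 1)), IsSolution h a U u du →
        ∃ G : Space d → Form d (s + 1), HasWeakPartial (innerSet U R) i du G ∧
          MemLpForm ∞ (innerSet U R) G ∧
          lpNormForm ∞ (innerSet U R) G ≤
            ENNReal.ofReal (C / R ^ ((k : ℝ) + (d : ℝ) / 2)) * lpNormForm 2 U du := by
  obtain ⟨C, hC, H⟩ := exists_partials_bound d s hlam (List.ofFn i)
  obtain ⟨K, hK, HK⟩ := exists_eLpNorm_le_lpNormForm d (s + 1)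
  set c : ℝ := (Fintype.card (Fin (s + 1) ↪o Fin d) : ℝ) with hc
  have hc0 : 0 ≤ c := Nat.cast_nonneg _
  -- `c` counts the coefficients summed in `lpNormForm`; the `+ 1` keeps the constant positive when
  -- `s + 1 > d`. The powers of `2` come from using balls of radius `R / 2`, and `K` compares the
  -- two `L²` norms.
  refine ⟨(c + 1) * √(C * 2 ^ (2 * k + d)) * K, by positivity, ?_⟩
  intro q h a ha U hU R hR u du hu
  set b : ℝ := √(C / (R / 2) ^ (2 * k + d)) with hb
  have hb0 : 0 ≤ b := Real.sqrt_nonneg _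
  set V := innerSet U R with hV
  have hVo : IsOpen V := isOpen_innerSet hU R
  have hVm : MeasurableSet V := hVo.measurableSet
  have hVU : V ⊆ U := fun x hx => hx.1
  have hfin : lpNormForm 2 U du < ⊤ := ENNReal.sum_lt_top.mpr fun I _ => (hu.memLp_deriv I).2
  have hdu2 := HK U du hu.memLp_deriv
  obtain ⟨f, hfm, hf, hfdu, hfn⟩ := exists_zero_extension hU.measurableSet
    (show MemLp du 2 (volume.restrict U) from
      ⟨aestronglyMeasurable_of_coeff fun I => (hu.memLp_deriv I).1,
        hdu2.trans_lt (ENNReal.mul_lt_top ENNReal.ofReal_lt_top hfin)⟩)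
  have hfloc : LocallyIntegrable f volume := hf.locallyIntegrable (by norm_num)
  set N : ℝ := (eLpNorm f 2 volume).toReal with hN
  have hN0 : 0 ≤ N := ENNReal.toReal_nonneg
  have hNle : ENNReal.ofReal N ≤ ENNReal.ofReal K * lpNormForm 2 U du := by
    rw [hN, ENNReal.ofReal_toReal hf.2.ne, hfn]
    exact hdu2
  set α : ℕ → ℝ := fun n => 1 / ((n : ℝ) + 1) with hα
  have hα0 : ∀ n, 0 ≤ α n := fun n => by positivity
  have hαt : Filter.Tendsto α Filter.atTop (𝓝 0) := tendsto_one_div_add_atTop_nhds_zero_nat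
  have hαa : Antitone α := fun m n hmn =>
    one_div_le_one_div_of_le (by positivity) (by exact_mod_cast Nat.succ_le_succ hmn)
  have hα1 : ∀ n, α n ≤ 1 := fun n => (hαa (Nat.zero_le n)).trans (by simp [hα])
  obtain ⟨φ, hφR, hφ⟩ := exists_mollify_approx hfm hf (half_pos hR)
  have hgs : ∀ n, ContDiff ℝ ∞ (mollify (φ n) f) := fun n => contDiff_mollify (φ n) hfloc
  have hgm : ∀ n, AEStronglyMeasurable (mollify (φ n) f) volume := fun n =>
    (hgs n).continuous.aestronglyMeasurable
  -- Half of `R` is spent on the ball of the estimate and the other half on the support of the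
  -- kernel.
  have hsol : ∀ n, ∀ x ∈ V, IsSmoothSol (energyForm h a) (Metric.ball x (R / 2)) (mollify (φ n) f) := by
    intro n x hx
    refine hu.isSmoothSol_mollify hfloc hfdu (φ n) fun y hy => ?_
    refine Set.Subset.trans (fun z hz => ?_) (ball_subset_of_mem_innerSet hU hx)
    rw [Metric.mem_ball] at hy ⊢
    rw [Metric.mem_closedBall] at hz
    linarith [dist_triangle z y x, hφR n]
  -- the interior estimate
  have hg2 : ∀ n, MemLp (mollify (φ n) f) 2 volume := fun n =>
    memLp_of_eLpNorm_sub_le hf (hgm n) (hφ n)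
  have key : ∀ x ∈ V, ∀ w, IsSmoothSol (energyForm h a) (Metric.ball x (R / 2)) w →
      MemLp w 2 volume → ‖partials (List.ofFn i) w x‖ ≤ b * (eLpNorm w 2 volume).toReal := by
    intro x hx w hw hw2
    have h1 := H _ ha.energyForm x (R / 2) (by positivity) w hw
    rw [List.length_ofFn] at h1
    have h2 := h1.trans (mul_le_mul_of_nonneg_left
      (setIntegral_sq_le_eLpNorm_sq hw2 (Metric.ball x (R / 2))) (by positivity))
    refine (sq_le_sq₀ (norm_nonneg _) (by positivity)).mp (h2.trans_eq ?_)
    rw [mul_pow, hb, Real.sq_sqrt (by positivity)]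
  -- By linearity the difference of two mollifications is a solution too, so `L²` closeness becomes
  -- uniform closeness of the derivatives on `V`.
  have hB1 : ∀ n m, ∀ x ∈ V,
      ‖partials (List.ofFn i) (mollify (φ n) f) x - partials (List.ofFn i) (mollify (φ m) f) x‖ ≤ b * (α n + α m) := by
    intro n m x hx
    have h1 := key x hx _ ((hsol n x hx).sub (hsol m x hx)) ((hg2 n).sub (hg2 m))
    rw [partials_sub (hgs n) (hgs m)] at h1
    exact h1.trans (by gcongr; exact toReal_eLpNorm_sub_le_add hf (hgm n) (hgm m) (hα0 n) (hα0 m) (hφ n) (hφ m))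
  have hB2 : ∀ n, ∀ x ∈ V, ‖partials (List.ofFn i) (mollify (φ n) f) x‖ ≤ b * (N + α n) := fun n x hx =>
    (key x hx _ (hsol n x hx) (hg2 n)).trans (by gcongr; exact toReal_eLpNorm_le_add hf (hgm n) (hα0 n) (hφ n))
  obtain ⟨G, hGm, hGb, hGw⟩ := exists_weak_limit hVm hf hgs hg2 hαt hαa hα1 hφ hb0
    (List.ofFn i) hB1 hB2
  have hGI : ∀ I, AEStronglyMeasurable (fun x => coeff (G x) I) (volume.restrict V) := fun I =>
    (coeffL I).continuous.comp_aestronglyMeasurable hGm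
  have hGIb : ∀ I, ∀ᵐ x ∂volume.restrict V, ‖coeff (G x) I‖ ≤ b * N := fun I => by
    filter_upwards [ae_restrict_mem hVm] with x hx
    exact (abs_coeff_le _ _).trans (hGb x hx)
  refine ⟨G, ?_, fun I => memLp_top_of_bound (hGI I) _ (hGIb I), ?_⟩
  · intro I ψ hψ hψc hψV
    simp only [iteratedFDeriv_eq_partials hψ]
    have hE := hGw (coeffL I) ψ hψ hψc hψV
    rw [List.length_ofFn] at hE
    refine Eq.trans ?_ hE
    refine integral_congr_ae ?_
    filter_upwards [ae_restrict_of_ae_restrict_of_subset hVU hfdu] with x hx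
    rw [hx]; rfl
  · have h1 : lpNormForm ∞ V G ≤ ENNReal.ofReal (c * (b * N)) := by
      calc lpNormForm ∞ V G ≤ ∑ _I : Fin (s + 1) ↪o Fin d, ENNReal.ofReal (b * N) := by
            refine Finset.sum_le_sum fun I _ => ?_
            rw [eLpNorm_exponent_top]
            exact eLpNormEssSup_le_of_ae_bound (hGIb I)
        _ = _ := by
            rw [Finset.sum_const, nsmul_eq_mul, ENNReal.ofReal_mul hc0, hc,
              ENNReal.ofReal_natCast, Finset.card_univ]
    have hRpos : 0 < R ^ ((k : ℝ) + (d : ℝ) / 2) := Real.rpow_pos_of_pos hR _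
    have hbR : b = √(C * 2 ^ (2 * k + d)) / R ^ ((k : ℝ) + (d : ℝ) / 2) := by
      have h2 : R ^ ((k : ℝ) + (d : ℝ) / 2) = √(R ^ (2 * k + d)) := by
        rw [Real.sqrt_eq_rpow, ← Real.rpow_natCast, ← Real.rpow_mul hR.le]
        congr 1
        push_cast
        ring
      rw [h2, ← Real.sqrt_div (by positivity), hb, div_pow]
      congr 1
      field_simp
    calc lpNormForm ∞ V G ≤ ENNReal.ofReal (c * (b * N)) := h1
      _ ≤ ENNReal.ofReal ((c + 1) * b * N) := by
          apply ENNReal.ofReal_le_ofReal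
          nlinarith [mul_nonneg hb0 hN0]
      _ = ENNReal.ofReal ((c + 1) * b) * ENNReal.ofReal N := ENNReal.ofReal_mul (by positivity)
      _ ≤ ENNReal.ofReal ((c + 1) * b) * (ENNReal.ofReal K * lpNormForm 2 U du) := by gcongr
      _ = _ := by
          rw [← mul_assoc, ← ENNReal.ofReal_mul (by positivity), hbR]
          congr 2
          ring

end

end FormRegularity

end

/-- Interior regularity for `d(a du) = 0`, where `u` has degree `s = r - 1` and `r + q = d`: the
iterated weak gradient `G = ∇^k du` exists in `L^∞ Λ^r(U_R)` and obeys the pointwise estimate. -/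
theorem propositionA3 (d k : ℕ) (lam : ℝ) (hlam0 : 0 < lam) (hlam1 : lam ≤ 1) :
    ∃ C : ℝ, 0 < C ∧
      ∀ (s q : ℕ) (h : (s + 1) + q = d)
        (a : FormRegularity.Form d (s + 1) →ₗ[ℝ] FormRegularity.Form d q),
        FormRegularity.IsEllipticCoeff h lam a →
      ∀ U : Set (FormRegularity.Space d), IsOpen U → Bornology.IsBounded U →
      ∀ R : ℝ, 0 < R →
      ∀ (u : FormRegularity.Space d → FormRegularity.Form d s)
        (du : FormRegularity.Space d → FormRegularity.Form d (s + 1)),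
        FormRegularity.IsSolution h a U u du →
        ∃ G : (Fin k → Fin d) → FormRegularity.Space d → FormRegularity.Form d (s + 1),
          (∀ i, FormRegularity.HasWeakPartial (FormRegularity.innerSet U R) i du (G i)) ∧
          (∀ i, FormRegularity.MemLpForm ∞ (FormRegularity.innerSet U R) (G i)) ∧
          ∑ i, FormRegularity.lpNormForm ∞ (FormRegularity.innerSet U R) (G i) ≤
            ENNReal.ofReal (C / R ^ ((k : ℝ) + (d : ℝ) / 2)) *
              FormRegularity.lpNormForm 2 U du := by
  choose C hC H using fun (s : ℕ) (i : Fin k → Fin d) => FormRegularity.exists_weakPartial d s hlam0 i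
  -- The degree relation forces `s < d`, so summing over `s` and over multi-indices makes the
  -- constant independent of the degree. The `1` guarantees positivity for empty sums.
  refine ⟨1 + ∑ s ∈ Finset.range d, ∑ i, C s i, ?_, ?_⟩
  · have : 0 ≤ ∑ s ∈ Finset.range d, ∑ i, C s i :=
      Finset.sum_nonneg fun s _ => Finset.sum_nonneg fun i _ => (hC s i).le
    linarith
  intro s q h a ha U hU _ R hR u du hu
  choose G hG1 hG2 hG3 using fun i => H s i q h a ha U hU R hR u du hu
  refine ⟨G, hG1, hG2, (Finset.sum_le_sum fun i _ => hG3 i).trans ?_⟩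
  rw [← Finset.sum_mul]
  gcongr
  have hpos : 0 < R ^ ((k : ℝ) + (d : ℝ) / 2) := Real.rpow_pos_of_pos hR _
  rw [← ENNReal.ofReal_sum_of_nonneg fun i _ => div_nonneg (hC s i).le hpos.le, ← Finset.sum_div]
  apply ENNReal.ofReal_le_ofReal
  gcongr
  have h1 : ∑ i, C s i ≤ ∑ s ∈ Finset.range d, ∑ i, C s i :=
    Finset.single_le_sum (f := fun s => ∑ i, C s i)
      (fun s _ => Finset.sum_nonneg fun i _ => (hC s i).le) (Finset.mem_range.mpr (by omega))
  linarith
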